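/- **Setting.** A *layered contextual MDP* (CMDP) with horizon $H$ consists of a finite context space $\mathcal C\subset\mathbb R^{d}$, finite sets $S$ of states and $A$ of actions, a distribution $\mathcal D$ on $\mathcal C$ and, for each context $c$, transition probabilities $P^c(\cdot\mid s,a)$ and reward distributions $R^c(s,a)$ on $[0,1]$ with means $r^c(s,a)$. The state space is partitioned into layers $S_0=\{s_0\},S_1,\dots,S_H=\{s_H\}$, transitions lead only from a layer to the next one, and the final state $s_H$ has reward $0$. The dynamics is *context-independent* if $P^c=P$ for all $c$. The value of a policy $\pi:S\to\Delta(A)$ is $V^{\pi}_c=\mathbb E\big[\sum_{h=0}^{H-1}r^c(s_h,a_h)\big]$, where $s_0,a_0,\dots,s_{H-1},a_{H-1}$ is generated by $\pi$ and $P^c$, and $V^\star_c=\max_\pi V^\pi_c$. In each episode $t=1,\dots,T$ a context $c_t\sim\mathcal D$ is drawn independently, a (possibly randomized) algorithm chooses a policy $\pi_t$ from $c_t$ and the past episodes, and it then observes the trajectory (states, actions and rewards) of $\pi_t$ under $c_t$. The expected regret is $\mathbb E\big[\sum_{t=1}^T (V^\star_{c_t}-V^{\pi_t}_{c_t})\big]$.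 A class $\mathcal G\subseteq(\mathcal C\times A\to[0,1])$ is *realizable* (for $\mathcal F=\mathcal G^S$) if for every $s\ne s_H$ there is $g_s\in\mathcal G$ with $r^c(s,a)=g_s(c,a)$ for all $c,a$. **Theorem (lower bound for CMDP).** There is an absolute constant $\kappa>0$ such that the following holds. Let $\delta\in(0,1)$, $H\ge 2$, $M\ge 1$, let $A$ be a finite set with $|A|\ge 2$, let $N\ge|A|$, let $S$ be a finite set with $|S|=M(H-1)+2$, and let $$T\ \ge\ 8M\ln\frac{|S|}{\delta}+2M\,\frac{\ln N}{\ln|A|}.$$ Then there are a finite context space $\mathcal C$ and context-independent layered dynamics $P$ on $S$ with horizon $H$, for which every policy visits every state with probability at least some $p_{\min}>0$, such that for every algorithm, which may know $T$, $\mathcal C$, $P$ and the class $\mathcal G$, there exist a class $\mathcal G\subseteq(\mathcal C\times A\to[0,1])$ with $|\mathcal G|\le N$ and a CMDP with dynamics $P$, for which $\mathcal G$ is realizable, on which the expected regret of the algorithm over $T$ episodes is at least $$\kappa\cdot\min\Big\{\sqrt{T\,H\,|S|\,|A|\,\frac{\ln N}{\ln|A|}},\ T H\Big\}.$$ -/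

import Mathlib

namespace CtxMDP

noncomputable section

/-- Expectation of a real function under a discrete distribution. It is only applied to bounded
functions, for which the series converges absolutely. -/
def expect {X : Type*} (p : PMF X) (f : X → ℝ) : ℝ :=
  ∑' x, (p x).toReal * f x

/-- A stochastic policy `S → Δ(A)`. -/
abbrev Policy (S A : Type*) := S → PMF A

/-- A trajectory `(s₀, a₀, r₀, …, s_{H-1}, a_{H-1}, r_{H-1}, s_H)`: the list of the
state-action-reward triples, and the last state. Rewards lie in `[0,1]`. -/
structure Trajectory (S A : Type*) where
  steps : List (S × A × unitInterval)
  last : S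

/-- Law of the trajectory of length `n` from the state `s`, for transitions `P`, reward laws `R`
and policy `π`. -/
def rollout {S A : Type*} (P : S → A → PMF S) (R : S → A → PMF unitInterval) (π : Policy S A) :
    ℕ → S → PMF (Trajectory S A)
  | 0, s => PMF.pure ⟨[], s⟩
  | n + 1, s =>
      (π s).bind fun a => (R s a).bind fun r => (P s a).bind fun s' =>
        (rollout P R π n s').map fun τ => ⟨(s, a, r) :: τ.steps, τ.last⟩

/-- Law of the state at time `h` of an episode which starts at `s`. -/
def stateLaw {S A : Type*} (P : S → A → PMF S) (π : Policy S A) (s : S) : ℕ → PMF S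
  | 0 => PMF.pure s
  | h + 1 => (stateLaw P π s h).bind fun x => (π x).bind fun a => P x a

/-- Layered (loop-free) dynamics with horizon `H`: the state space is partitioned into the layers
`S_h = {s | layer s = h}`, `h = 0, …, H`, with a unique start state `S_0 = {start}` and a unique
final state `S_H = {final}`, and transitions are possible only from a layer to the next one.
(An episode ends on reaching `final`, so the transitions out of `final` are irrelevant.) -/
structure LayeredDynamics (S A : Type*) (H : ℕ) where
  trans : S → A → PMF S
  start : S
  final : S
  layer : S → ℕ
  layer_le : ∀ s, layer s ≤ H
  layer_eq_zero_iff : ∀ s, layer s = 0 ↔ s = start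
  layer_eq_horizon_iff : ∀ s, layer s = H ↔ s = final
  layer_succ : ∀ s a s', s ≠ final → s' ∈ (trans s a).support → layer s' = layer s + 1

/-- Minimum reachability: every policy visits every state with probability at least `p`. -/
def LayeredDynamics.MinReachable {S A : Type*} {H : ℕ} (P : LayeredDynamics S A H) (p : ℝ) : Prop :=
  ∀ (π : Policy S A) (s : S), p ≤ (stateLaw P.trans π P.start (P.layer s) s).toReal

/-- A stochastic contextual MDP: each context `c` determines layered dynamics and reward laws
`R^c(s,a)` on `[0,1]`, and contexts are drawn from `ctxLaw`. The final state has reward `0`. -/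
structure CMDP (C S A : Type*) (H : ℕ) where
  ctxLaw : PMF C
  dyn : C → LayeredDynamics S A H
  reward : C → S → A → PMF unitInterval
  reward_final : ∀ c a, reward c (dyn c).final a = PMF.pure 0

namespace CMDP

variable {C S A : Type*} {H : ℕ}

/-- The expected reward `r^c(s,a)`. -/
def meanReward (M : CMDP C S A H) (c : C) (s : S) (a : A) : ℝ :=
  expect (M.reward c s a) fun r => (r : ℝ)

/-- Law of the trajectory of an episode with context `c` and policy `π`. -/
def trajLaw (M : CMDP C S A H) (c : C) (π : Policy S A) : PMF (Trajectory S A) :=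
  rollout (M.dyn c).trans (M.reward c) π H (M.dyn c).start

/-- The value `V^π_{M(c)}(s₀) = E[∑_{k<H} r^c(s_k, a_k)]`. -/
def value (M : CMDP C S A H) (c : C) (π : Policy S A) : ℝ :=
  expect (M.trajLaw c π) fun τ => (τ.steps.map fun x => M.meanReward c x.1 x.2.1).sum

/-- The optimal value for the context `c`, a supremum over all stochastic policies
(the values lie in `[0,H]`). -/
def optValue (M : CMDP C S A H) (c : C) : ℝ :=
  ⨆ π : Policy S A, M.value c π

/-- Realizability for `F = G^S`: at each state in which an action is taken, the expected reward,
as a function of the context and the action, belongs to `G`. -/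
def Realizable (M : CMDP C S A H) (G : Finset (C → A → unitInterval)) : Prop :=
  ∃ f : S → C → A → unitInterval, (∀ s, f s ∈ G) ∧
    ∀ c s a, s ≠ (M.dyn c).final → M.meanReward c s a = (f s c a : ℝ)

end CMDP

/-- What the learner has seen after an episode: the context, the policy that it has played, and the
trajectory. -/
structure Episode (C S A : Type*) where
  ctx : C
  policy : Policy S A
  traj : Trajectory S A

/-- A (randomized) algorithm: from the past episodes, in chronological order, and the current
context, it chooses at random the policy of the current episode. -/
abbrev Learner (C S A : Type*) :=
  List (Episode C S A) → C → PMF (Policy S A)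

namespace CMDP

variable {C S A : Type*} {H : ℕ}

/-- Law of the first `T` episodes of the interaction of the learner `L` with `M`. -/
def runLaw (M : CMDP C S A H) (L : Learner C S A) : ℕ → PMF (List (Episode C S A))
  | 0 => PMF.pure []
  | t + 1 =>
      (M.runLaw L t).bind fun h => M.ctxLaw.bind fun c => (L h c).bind fun π =>
        (M.trajLaw c π).map fun τ => h ++ [⟨c, π, τ⟩]

/-- `Regret_T = ∑_t (V^{π*}_{M(c_t)}(s₀) - V^{π_t}_{M(c_t)}(s₀))`. -/
def regret (M : CMDP C S A H) (h : List (Episode C S A)) : ℝ :=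
  (h.map fun e => M.optValue e.ctx - M.value e.ctx e.policy).sum

/-- Expected regret over `T` episodes; the expectation is over the contexts, the randomization of
the learner and the history. -/
def expectedRegret (M : CMDP C S A H) (L : Learner C S A) (T : ℕ) : ℝ :=
  expect (M.runLaw L T) M.regret

end CMDP

end

end CtxMDP

/-! The hard instances hide many independent bandit problems in one CMDP. Let `K = Nat.log |A| N`,
take `K` equally likely contexts, and let every action lead to a uniform state of the next layer.
Actions then influence only rewards, and each pair `(s, c)` with `s` in an inner layer is met in an
episode with probability `1 / (K M)`. Rewards are Bernoulli of mean `1 / 2`, raised by `ε` at one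
secret action `φ (s, c)`. The class of all functions `1 / 2 + ε 1{a = φ c}` has at most `|A| ^ K ≤
N` elements and contains every choice of `φ`. It is thus fixed before `φ`, and knowing it reveals
nothing about the secret.

Fix `(s, c)`, and compare the instance with best action `a` there to the one with no best action
there (`none`). The histories differ only through rewards of `a` at `(s, c)`, so their relative
entropy is at most `3 ε² / (K M)` times the total, over the past episodes, of the probabilities of
choosing `a` there. A Pinsker-type inequality bounds the probability of playing `a` under the first
instance (`expect_playProb_le`). Under the `none` instance the play probabilities sum to `1` over
`a`. Hence, summed over `a`, the entropy terms are of order `ε² T / (K M)`, and for `ε` of order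
`√(|A| K M / T)` the best action is played with average probability at most `3 / 4`
(`sum_expect_playProb_le`).

Averaging over `φ`, each of the `H - 1` inner layers costs at least `ε / 4` per episode, so some `φ`
has regret at least `ε T (H - 1) / 4` (`exists_expectedRegret_ge`). The cap `ε ≤ 1 / 4` produces the
alternative `T H` in the minimum (`rate_le`). -/

namespace CtxMDP

noncomputable section

/-! ### Expectations under discrete laws -/

section Expectation

variable {X Y : Type*}

lemma summable_toReal (p : PMF X) : Summable fun x => (p x).toReal :=
  ENNReal.summable_toReal p.tsum_coe_ne_top

lemma tsum_toReal (p : PMF X) : ∑' x, (p x).toReal = 1 := by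
  rw [← ENNReal.tsum_toReal_eq fun x => p.apply_ne_top x, p.tsum_coe, ENNReal.toReal_one]

/-- The bound is asked only where the weight is nonzero: path sums are bounded on the support of the
trajectory law, where the length is known, but not on all lists. -/
lemma summable_mul_of_bounded {w f : X → ℝ} (hw : Summable w) (hw0 : ∀ x, 0 ≤ w x) {B : ℝ}
    (hf : ∀ x, w x ≠ 0 → |f x| ≤ B) : Summable fun x => w x * f x := by
  refine Summable.of_norm_bounded (hw.mul_right B) fun x => ?_
  rw [Real.norm_eq_abs, abs_mul, abs_of_nonneg (hw0 x)]
  by_cases h : w x = 0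
  · simp [h]
  · exact mul_le_mul_of_nonneg_left (hf x h) (hw0 x)

lemma mem_support_of_toReal_ne_zero {p : PMF X} {x : X} (h : (p x).toReal ≠ 0) :
    x ∈ p.support := by
  rw [PMF.mem_support_iff]
  intro h0
  simp [h0] at h

/-- A function bounded on the support is integrable. -/
lemma summable_expect {p : PMF X} {f : X → ℝ} {B : ℝ} (hf : ∀ x ∈ p.support, |f x| ≤ B) :
    Summable fun x => (p x).toReal * f x :=
  summable_mul_of_bounded (summable_toReal p) (fun _ => ENNReal.toReal_nonneg)
    fun x hx => hf x (mem_support_of_toReal_ne_zero hx)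

lemma expect_const (p : PMF X) (b : ℝ) : expect p (fun _ => b) = b := by
  rw [expect, tsum_mul_right, tsum_toReal, one_mul]

lemma expect_congr {p : PMF X} {f g : X → ℝ} (h : ∀ x ∈ p.support, f x = g x) :
    expect p f = expect p g := by
  refine tsum_congr fun x => ?_
  by_cases hx : x ∈ p.support
  · rw [h x hx]
  · rw [PMF.mem_support_iff, not_not] at hx
    simp [hx]

lemma expect_le_expect {p : PMF X} {f g : X → ℝ}
    (hf : Summable fun x => (p x).toReal * f x) (hg : Summable fun x => (p x).toReal * g x)
    (h : ∀ x ∈ p.support, f x ≤ g x) : expect p f ≤ expect p g := by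
  refine Summable.tsum_le_tsum (fun x => ?_) hf hg
  by_cases hx : x ∈ p.support
  · exact mul_le_mul_of_nonneg_left (h x hx) ENNReal.toReal_nonneg
  · rw [PMF.mem_support_iff, not_not] at hx
    simp [hx]

lemma expect_mono {p : PMF X} {f g : X → ℝ} {B B' : ℝ} (hf : ∀ x ∈ p.support, |f x| ≤ B)
    (hg : ∀ x ∈ p.support, |g x| ≤ B') (h : ∀ x ∈ p.support, f x ≤ g x) :
    expect p f ≤ expect p g :=
  expect_le_expect (summable_expect hf) (summable_expect hg) h

lemma abs_expect_le {p : PMF X} {f : X → ℝ} {B : ℝ} (hf : ∀ x ∈ p.support, |f x| ≤ B) :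
    |expect p f| ≤ B := by
  have hB : ∀ x ∈ p.support, |(fun _ => B) x| ≤ |B| := fun _ _ => le_rfl
  have hB' : ∀ x ∈ p.support, |(fun _ => -B) x| ≤ |-B| := fun _ _ => le_rfl
  rw [abs_le]
  constructor
  · rw [← expect_const p (-B)]
    exact expect_mono hB' hf fun x hx => (abs_le.1 (hf x hx)).1
  · rw [← expect_const p B]
    exact expect_mono hf hB fun x hx => (abs_le.1 (hf x hx)).2

lemma expect_add {p : PMF X} {f g : X → ℝ} (hf : Summable fun x => (p x).toReal * f x)
    (hg : Summable fun x => (p x).toReal * g x) :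
    expect p (fun x => f x + g x) = expect p f + expect p g := by
  simp only [expect, mul_add]
  exact hf.tsum_add hg

lemma expect_const_mul (p : PMF X) (b : ℝ) (f : X → ℝ) :
    expect p (fun x => b * f x) = b * expect p f := by
  simp only [expect, ← tsum_mul_left]
  exact tsum_congr fun x => by ring

lemma expect_sub {p : PMF X} {f g : X → ℝ} (hf : Summable fun x => (p x).toReal * f x)
    (hg : Summable fun x => (p x).toReal * g x) :
    expect p (fun x => f x - g x) = expect p f - expect p g := by
  simp only [expect, mul_sub]
  exact hf.tsum_sub hg

lemma expect_sum {ι : Type*} {p : PMF X} (s : Finset ι) {f : ι → X → ℝ}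
    (hf : ∀ i ∈ s, Summable fun x => (p x).toReal * f i x) :
    expect p (fun x => ∑ i ∈ s, f i x) = ∑ i ∈ s, expect p (f i) := by
  simp only [expect, Finset.mul_sum]
  exact Summable.tsum_finsetSum hf

lemma expect_eq_sum [Fintype X] (p : PMF X) (f : X → ℝ) :
    expect p f = ∑ x, (p x).toReal * f x :=
  tsum_fintype _

lemma expect_pure (x : X) (f : X → ℝ) : expect (PMF.pure x) f = f x := by
  rw [expect, tsum_eq_single x]
  · simp
  · intro y hy
    simp [hy]

/-- Fubini for a composed experiment. -/
lemma expect_bind {p : PMF X} {k : X → PMF Y} {f : Y → ℝ} {B : ℝ}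
    (hf : ∀ x ∈ p.support, ∀ y ∈ (k x).support, |f y| ≤ B) :
    expect (p.bind k) f = expect p fun x => expect (k x) f := by
  -- Summability of the joint law, together with the bound on `f`, permits the exchange of the two
  -- series.
  have hsum : Summable fun z : X × Y => (p z.1 * k z.1 z.2).toReal := by
    refine ENNReal.summable_toReal ?_
    rw [ENNReal.tsum_prod (f := fun x y => p x * k x y)]
    simp [ENNReal.tsum_mul_left]
  have hsum' : Summable fun z : X × Y => (p z.1 * k z.1 z.2).toReal * f z.2 := by
    refine summable_mul_of_bounded hsum (fun _ => ENNReal.toReal_nonneg) (B := B) fun z hz => ?_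
    rw [ENNReal.toReal_mul] at hz
    exact hf z.1 (mem_support_of_toReal_ne_zero (left_ne_zero_of_mul hz)) z.2
      (mem_support_of_toReal_ne_zero (right_ne_zero_of_mul hz))
  calc expect (p.bind k) f = ∑' y, ∑' x, (p x * k x y).toReal * f y := by
        refine tsum_congr fun y => ?_
        rw [PMF.bind_apply, ENNReal.tsum_toReal_eq, tsum_mul_right]
        exact fun x => ENNReal.mul_ne_top (p.apply_ne_top x) ((k x).apply_ne_top y)
    _ = ∑' x, ∑' y, (p x * k x y).toReal * f y :=
        Summable.tsum_comm (f := fun x y => (p x * k x y).toReal * f y) hsum'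
    _ = expect p fun x => expect (k x) f := by
        refine tsum_congr fun x => ?_
        change _ = (p x).toReal * ∑' y, (k x y).toReal * f y
        rw [← tsum_mul_left]
        exact tsum_congr fun y => by rw [ENNReal.toReal_mul, mul_assoc]

lemma expect_map {p : PMF X} {k : X → Y} {f : Y → ℝ} {B : ℝ}
    (hf : ∀ x ∈ p.support, |f (k x)| ≤ B) :
    expect (p.map k) f = expect p fun x => f (k x) := by
  rw [PMF.map, expect_bind (B := B)]
  · simp [expect_pure]
  · intro x hx y hy
    simp only [Function.comp_apply, PMF.support_pure, Set.mem_singleton_iff] at hy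
    rw [hy]
    exact hf x hx

lemma expect_nonneg {p : PMF X} {f : X → ℝ} (hf : ∀ x, 0 ≤ f x) : 0 ≤ expect p f :=
  tsum_nonneg fun x => mul_nonneg ENNReal.toReal_nonneg (hf x)

lemma expect_le_of_le {p : PMF X} {f : X → ℝ} {b : ℝ} (h0 : ∀ x, 0 ≤ f x) (h1 : ∀ x, f x ≤ b) :
    expect p f ≤ b :=
  (le_abs_self _).trans
    (abs_expect_le fun x _ => (abs_of_nonneg (h0 x)).le.trans (h1 x))

end Expectation

/-! ### Additive functionals of trajectories and histories -/

section Additive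

variable {C S A : Type*} {H : ℕ}

lemma abs_sum_map_le {X : Type*} {g : X → ℝ} {B : ℝ} :
    ∀ l : List X, (∀ x ∈ l, |g x| ≤ B) → |(l.map g).sum| ≤ l.length * B
  | [], _ => by simp
  | x :: l, h => by
      have h1 := h x (by simp)
      have h2 := abs_sum_map_le l fun y hy => h y (by simp [hy])
      simp only [List.map_cons, List.sum_cons, List.length_cons, Nat.cast_add, Nat.cast_one]
      linarith [abs_add_le (g x) (l.map g).sum]

/-- The sum of a cost over the steps of a trajectory. -/
def stepSum (g : S → A → unitInterval → ℝ) (τ : Trajectory S A) : ℝ :=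
  (τ.steps.map fun x => g x.1 x.2.1 x.2.2).sum

lemma length_of_mem_support_rollout {P : S → A → PMF S} {R : S → A → PMF unitInterval}
    {π : Policy S A} : ∀ (n : ℕ) (s : S), ∀ τ ∈ (rollout P R π n s).support, τ.steps.length = n
  | 0, s, τ, h => by
      simp only [rollout, PMF.support_pure, Set.mem_singleton_iff] at h
      simp [h]
  | n + 1, s, τ, h => by
      simp only [rollout, PMF.mem_support_bind_iff, PMF.mem_support_map_iff] at h
      obtain ⟨a, -, r, -, s', -, τ', hτ', rfl⟩ := h
      simp [length_of_mem_support_rollout n s' τ' hτ']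

lemma abs_stepSum_le {P : S → A → PMF S} {R : S → A → PMF unitInterval} {π : Policy S A}
    {g : S → A → unitInterval → ℝ} {B : ℝ} (hg : ∀ s a r, |g s a r| ≤ B) {n : ℕ} {s : S}
    {τ : Trajectory S A} (hτ : τ ∈ (rollout P R π n s).support) : |stepSum g τ| ≤ n * B := by
  have := abs_sum_map_le τ.steps (g := fun x => g x.1 x.2.1 x.2.2) (B := B) fun x _ => hg _ _ _
  rwa [length_of_mem_support_rollout n s τ hτ] at this

/-- The Bellman equation for an additive cost. -/
lemma expect_rollout_succ {P : S → A → PMF S} {R : S → A → PMF unitInterval} {π : Policy S A}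
    {g : S → A → unitInterval → ℝ} {B : ℝ} (hg : ∀ s a r, |g s a r| ≤ B) (n : ℕ) (s : S) :
    expect (rollout P R π (n + 1) s) (stepSum g) =
      expect (π s) fun a => expect (R s a) (g s a) +
        expect (P s a) fun s' => expect (rollout P R π n s') (stepSum g) := by
  have hb : ∀ τ ∈ (rollout P R π (n + 1) s).support, |stepSum g τ| ≤ (n + 1 : ℕ) * B :=
    fun τ hτ => abs_stepSum_le hg hτ
  simp only [rollout, PMF.mem_support_bind_iff] at hb
  rw [rollout, expect_bind (B := (n + 1 : ℕ) * B) fun a ha τ hτ => hb τ ⟨a, ha, by simpa using hτ⟩]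
  refine expect_congr fun a ha => ?_
  rw [expect_bind (B := (n + 1 : ℕ) * B) fun r hr τ hτ => hb τ ⟨a, ha, r, hr, by simpa using hτ⟩]
  have hv : ∀ s' ∈ (P s a).support, |expect (rollout P R π n s') (stepSum g)| ≤ n * B :=
    fun s' _ => abs_expect_le fun τ hτ => abs_stepSum_le hg hτ
  have hstep : ∀ r ∈ (R s a).support,
      expect ((P s a).bind fun s' => (rollout P R π n s').map fun τ =>
        (⟨(s, a, r) :: τ.steps, τ.last⟩ : Trajectory S A)) (stepSum g) =
      g s a r + expect (P s a) fun s' => expect (rollout P R π n s') (stepSum g) := by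
    intro r hr
    rw [expect_bind (B := (n + 1 : ℕ) * B) fun s' hs' τ hτ => hb τ ⟨a, ha, r, hr, s', hs', hτ⟩]
    have : ∀ s' ∈ (P s a).support,
        expect ((rollout P R π n s').map fun τ =>
          (⟨(s, a, r) :: τ.steps, τ.last⟩ : Trajectory S A)) (stepSum g) =
        g s a r + expect (rollout P R π n s') (stepSum g) := by
      intro s' hs'
      rw [expect_map (B := (n + 1 : ℕ) * B) fun τ hτ => hb _ ⟨a, ha, r, hr, s', hs', by
        rw [PMF.mem_support_map_iff]; exact ⟨τ, hτ, rfl⟩⟩]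
      have : ∀ τ : Trajectory S A, stepSum g ⟨(s, a, r) :: τ.steps, τ.last⟩ =
          g s a r + stepSum g τ := fun τ => by simp [stepSum]
      simp only [this]
      rw [expect_add (summable_expect (B := B) fun _ _ => hg s a r)
        (summable_expect (B := n * B) fun τ hτ => abs_stepSum_le hg hτ), expect_const]
    rw [expect_congr this, expect_add (summable_expect (B := B) fun _ _ => hg s a r)
      (summable_expect hv), expect_const]
  rw [expect_congr hstep, expect_add (summable_expect (B := B) fun r _ => hg s a r)
    (summable_expect (B := n * B) fun _ _ => abs_expect_le hv), expect_const]

/-- If the transitions out of the layer `l` have the law `ν (l + 1)`, independently of the state and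
the action, an additive cost decouples over the layers. -/
lemma expect_rollout_of_layered {R : S → A → PMF unitInterval} {π : Policy S A}
    {g : S → A → unitInterval → ℝ} {B : ℝ} (hg : ∀ s a r, |g s a r| ≤ B) {ν : ℕ → PMF S}
    {lay : S → ℕ} (hν : ∀ l < H, ∀ s ∈ (ν l).support, lay s = l) :
    ∀ n l, l + n ≤ H →
      (expect (ν l) fun s => expect (rollout (fun s _ => ν (lay s + 1)) R π n s) (stepSum g)) =
        ∑ j ∈ Finset.range n,
          expect (ν (l + j)) fun s => expect (π s) fun a => expect (R s a) (g s a)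
  | 0, l, _ => by
      simp only [rollout, expect_pure, Finset.range_zero, Finset.sum_empty]
      simp [stepSum, expect_const]
  | n + 1, l, h => by
      have ih := expect_rollout_of_layered hg (R := R) (π := π) hν n (l + 1) (by omega)
      have hc : ∀ s a, |expect (R s a) (g s a)| ≤ B := fun s a => abs_expect_le fun r _ => hg s a r
      have hs : ∀ s ∈ (ν l).support,
          expect (rollout (fun s _ => ν (lay s + 1)) R π (n + 1) s) (stepSum g) =
          (expect (π s) fun a => expect (R s a) (g s a)) + ∑ j ∈ Finset.range n,
            expect (ν (l + 1 + j)) fun s => expect (π s) fun a => expect (R s a) (g s a) := by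
        intro s hs
        -- On the support of `ν l` the next-state law is the constant `ν (l + 1)`, so the future
        -- term depends on neither state nor action.
        rw [expect_rollout_succ hg, hν l (by omega) s hs, ih,
          expect_add (summable_expect (B := B) fun a _ => hc s a)
            (summable_expect fun _ _ => le_rfl), expect_const]
      rw [expect_congr hs, expect_add
        (summable_expect (B := B) fun s _ => abs_expect_le fun a _ => hc s a)
        (summable_expect fun _ _ => le_rfl), expect_const, Finset.sum_range_succ', add_comm]
      simp only [Nat.add_zero, add_assoc, add_comm 1]

lemma abs_sum_runLaw_le {E : CMDP C S A H} {L : Learner C S A} {G : Episode C S A → ℝ} {B : ℝ}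
    (hG : ∀ c π, ∀ τ ∈ (E.trajLaw c π).support, |G ⟨c, π, τ⟩| ≤ B) :
    ∀ t, ∀ h ∈ (E.runLaw L t).support, |(h.map G).sum| ≤ t * B
  | 0, h, hh => by
      simp only [CMDP.runLaw, PMF.support_pure, Set.mem_singleton_iff] at hh
      simp [hh]
  | t + 1, h, hh => by
      simp only [CMDP.runLaw, PMF.mem_support_bind_iff, PMF.mem_support_map_iff] at hh
      obtain ⟨h', hh', c, -, π, -, τ, hτ, rfl⟩ := hh
      have h1 := abs_sum_runLaw_le hG t h' hh'
      have h2 := hG c π τ hτ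
      simp only [List.map_append, List.map_cons, List.map_nil, List.sum_append, List.sum_cons,
        List.sum_nil, add_zero, Nat.cast_add, Nat.cast_one]
      linarith [abs_add_le (h'.map G).sum (G ⟨c, π, τ⟩)]

/-- The expected value of `G` at the episode which follows the history `h`. -/
def nextMean (E : CMDP C S A H) (L : Learner C S A) (G : Episode C S A → ℝ)
    (h : List (Episode C S A)) : ℝ :=
  expect E.ctxLaw fun c => expect (L h c) fun π => expect (E.trajLaw c π) fun τ => G ⟨c, π, τ⟩

lemma abs_nextMean_le {E : CMDP C S A H} {L : Learner C S A} {G : Episode C S A → ℝ} {B : ℝ}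
    (hG : ∀ c π, ∀ τ ∈ (E.trajLaw c π).support, |G ⟨c, π, τ⟩| ≤ B) (h : List (Episode C S A)) :
    |nextMean E L G h| ≤ B :=
  abs_expect_le fun c _ => abs_expect_le fun π _ => abs_expect_le fun τ hτ => hG c π τ hτ

/-- Tower property: each episode contributes its conditional mean given the past. It serves twice,
for the regret and for the log-likelihood ratio of histories. -/
lemma expect_runLaw_sum {E : CMDP C S A H} {L : Learner C S A} {G : Episode C S A → ℝ} {B : ℝ}
    (hG : ∀ c π, ∀ τ ∈ (E.trajLaw c π).support, |G ⟨c, π, τ⟩| ≤ B) :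
    ∀ t, expect (E.runLaw L t) (fun h => (h.map G).sum) =
      ∑ i ∈ Finset.range t, expect (E.runLaw L i) (nextMean E L G)
  | 0 => by simp [CMDP.runLaw, expect_pure]
  | t + 1 => by
      have hb := abs_sum_runLaw_le (L := L) hG (t + 1)
      have hbt := abs_sum_runLaw_le (L := L) hG t
      simp only [CMDP.runLaw, PMF.mem_support_bind_iff] at hb
      rw [Finset.sum_range_succ, ← expect_runLaw_sum hG t, CMDP.runLaw,
        ← expect_add (summable_expect hbt)
          (summable_expect fun h _ => abs_nextMean_le (L := L) hG h),
        expect_bind (B := (t + 1 : ℕ) * B) fun h hh h' hh' => hb h' ⟨h, hh, by simpa using hh'⟩]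
      refine expect_congr fun h hh => ?_
      rw [expect_bind (B := (t + 1 : ℕ) * B)
        fun c hc h' hh' => hb h' ⟨h, hh, c, hc, by simpa using hh'⟩]
      have hmain : ∀ c ∈ E.ctxLaw.support,
          expect ((L h c).bind fun π => (E.trajLaw c π).map fun τ =>
            h ++ [(⟨c, π, τ⟩ : Episode C S A)]) (fun h => (h.map G).sum) =
          (h.map G).sum + expect (L h c) fun π => expect (E.trajLaw c π) fun τ => G ⟨c, π, τ⟩ := by
        intro c hc
        rw [expect_bind (B := (t + 1 : ℕ) * B)
          fun π hπ h' hh' => hb h' ⟨h, hh, c, hc, π, hπ, hh'⟩]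
        have : ∀ π ∈ (L h c).support,
            expect ((E.trajLaw c π).map fun τ => h ++ [(⟨c, π, τ⟩ : Episode C S A)])
              (fun h => (h.map G).sum) =
            (h.map G).sum + expect (E.trajLaw c π) fun τ => G ⟨c, π, τ⟩ := by
          intro π hπ
          rw [expect_map (k := fun τ => h ++ [(⟨c, π, τ⟩ : Episode C S A)])
            (f := fun h => (h.map G).sum) (B := (t + 1 : ℕ) * B)
            fun τ hτ => hb _ ⟨h, hh, c, hc, π, hπ, by
            rw [PMF.mem_support_map_iff]; exact ⟨τ, hτ, rfl⟩⟩]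
          simp only [List.map_append, List.map_cons, List.map_nil, List.sum_append, List.sum_cons,
            List.sum_nil, add_zero]
          rw [expect_add (summable_expect fun _ _ => le_rfl) (summable_expect (hG c π)),
            expect_const]
        rw [expect_congr this, expect_add (summable_expect fun _ _ => le_rfl)
          (summable_expect fun π _ => abs_expect_le (hG c π)), expect_const]
      rw [expect_congr hmain, expect_add (summable_expect fun _ _ => le_rfl)
        (summable_expect fun c _ => abs_expect_le fun π _ => abs_expect_le (hG c π)),
        expect_const]
      rfl

end Additive

/-! ### Change of measure and a Pinsker-type inequality -/

section ChangeOfMeasure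

variable {X Y : Type*}

/-- The law `q` has the density `exp (u x - b)` with respect to `p`. -/
def HasLogDensity (p q : PMF X) (b : ℝ) (u : X → ℝ) : Prop :=
  ∀ x, q x * ENNReal.ofReal (Real.exp b) = p x * ENNReal.ofReal (Real.exp (u x))

/-- Chain rule for likelihood ratios. The log-ratio `u x` accumulated in the first stage becomes the
offset of the second, so that it telescopes; this is the purpose of the parameter `b`. In `ENNReal`
no summability is needed. -/
lemma HasLogDensity.bind {p q : PMF X} {b : ℝ} {u : X → ℝ} (h : HasLogDensity p q b u)
    {k k' : X → PMF Y} {v : Y → ℝ} (hk : ∀ x, HasLogDensity (k x) (k' x) (u x) v) :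
    HasLogDensity (p.bind k) (q.bind k') b v := by
  intro y
  rw [PMF.bind_apply, PMF.bind_apply, ← ENNReal.tsum_mul_right, ← ENNReal.tsum_mul_right]
  refine tsum_congr fun x => ?_
  rw [mul_right_comm, h x, mul_assoc, mul_comm (ENNReal.ofReal _), hk x y, mul_assoc]

lemma HasLogDensity.bind_right {p : PMF X} {b : ℝ} {k k' : X → PMF Y} {v : Y → ℝ}
    (hk : ∀ x, HasLogDensity (k x) (k' x) b v) : HasLogDensity (p.bind k) (p.bind k') b v :=
  HasLogDensity.bind (u := fun _ => b) (fun _ => rfl) hk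

lemma HasLogDensity.map {p q : PMF X} {b : ℝ} {u : X → ℝ} (h : HasLogDensity p q b u)
    {f : X → Y} {v : Y → ℝ} (hv : ∀ x, v (f x) = u x) :
    HasLogDensity (p.map f) (q.map f) b v := by
  refine h.bind fun x y => ?_
  by_cases hy : y = f x
  · rw [hy, hv]
  · simp [hy]

lemma HasLogDensity.add_const {p q : PMF X} {b : ℝ} {u : X → ℝ} (h : HasLogDensity p q b u)
    (d : ℝ) : HasLogDensity p q (d + b) fun x => d + u x := by
  intro x
  rw [Real.exp_add, Real.exp_add, ENNReal.ofReal_mul (Real.exp_pos _).le,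
    ENNReal.ofReal_mul (Real.exp_pos _).le, mul_left_comm, h x, mul_left_comm]

lemma HasLogDensity.toReal_eq {p q : PMF X} {u : X → ℝ} (h : HasLogDensity p q 0 u) (x : X) :
    (q x).toReal = (p x).toReal * Real.exp (u x) := by
  have := congrArg ENNReal.toReal (h x)
  rwa [ENNReal.toReal_mul, ENNReal.toReal_mul, Real.exp_zero, ENNReal.ofReal_one,
    ENNReal.toReal_one, mul_one, ENNReal.toReal_ofReal (Real.exp_pos _).le] at this

/-- Pointwise form of Pinsker's inequality. With `v = exp (u / 2)`, the product `(v - 1)(v + 1)` is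
split by the AM-GM inequality with weight `η`, and `(v - 1)² ≤ exp u - 1 - u` because `v ≥ 1 + u /
2`. In expectation the last expression becomes the relative entropy. -/
lemma exp_sub_one_mul_le {u f η : ℝ} (hf0 : 0 ≤ f) (hf1 : f ≤ 1) (hη : 0 < η) :
    (Real.exp u - 1) * f ≤ η * (1 + Real.exp u) + (Real.exp u - 1 - u) / (2 * η) := by
  set v := Real.exp (u / 2) with hv
  have hu : Real.exp u = v * v := by rw [hv, ← Real.exp_add]; ring_nf
  have hv1 : u / 2 + 1 ≤ v := Real.add_one_le_exp _
  have hv0 : 0 < v := Real.exp_pos _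
  have h1 : (v - 1) ^ 2 / (2 * η) ≤ (Real.exp u - 1 - u) / (2 * η) := by
    rw [hu]
    gcongr
    nlinarith
  have h2 : (v - 1) * (v + 1) ≤ η * (v + 1) ^ 2 / 2 + (v - 1) ^ 2 / (2 * η) := by
    have h3 : η * (v + 1) ^ 2 / 2 + (v - 1) ^ 2 / (2 * η) - (v - 1) * (v + 1) =
        (η * (v + 1) - (v - 1)) ^ 2 / (2 * η) := by
      field_simp
      ring
    have h4 : 0 ≤ (η * (v + 1) - (v - 1)) ^ 2 / (2 * η) := by positivity
    linarith
  have h5 : η * (v + 1) ^ 2 / 2 ≤ η * (1 + v * v) := by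
    nlinarith [mul_nonneg hη.le (sq_nonneg (v - 1))]
  have h6 : 0 ≤ η * (1 + v * v) + (v - 1) ^ 2 / (2 * η) := by positivity
  have h7 : (v * v - 1) * f ≤ η * (1 + v * v) + (v - 1) ^ 2 / (2 * η) := by
    rcases le_total 0 (v * v - 1) with h | h
    · nlinarith [mul_le_of_le_one_right h hf1]
    · exact (mul_nonpos_of_nonpos_of_nonneg h hf0).trans h6
  rw [hu] at h1 ⊢
  linarith

/-- Comparison of expectations by the relative entropy `-E_p[u]`. -/
lemma HasLogDensity.expect_le {p q : PMF X} {u : X → ℝ} (h : HasLogDensity p q 0 u) {B : ℝ}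
    (hu : ∀ x ∈ p.support, |u x| ≤ B) {f : X → ℝ} (hf0 : ∀ x, 0 ≤ f x) (hf1 : ∀ x, f x ≤ 1)
    {η : ℝ} (hη : 0 < η) :
    expect q f ≤ expect p f + 2 * η - expect p u / (2 * η) := by
  have hfb : ∀ x, |f x| ≤ 1 := fun x => (abs_of_nonneg (hf0 x)).le.trans (hf1 x)
  have hq : expect q f = expect p fun x => Real.exp (u x) * f x :=
    tsum_congr fun x => by rw [h.toReal_eq, mul_assoc]
  -- The density integrates to one, which leaves only `-E_p[u]` of the quadratic term.
  have hone : expect p (fun x => Real.exp (u x)) = 1 := by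
    rw [← tsum_toReal q]
    exact tsum_congr fun x => (h.toReal_eq x).symm
  have s1 : Summable fun x => (p x).toReal * Real.exp (u x) :=
    (summable_toReal q).congr fun x => h.toReal_eq x
  have s2 : Summable fun x => (p x).toReal * (Real.exp (u x) * f x) := by
    simp only [← mul_assoc]
    exact summable_mul_of_bounded s1 (fun x => by positivity) fun x _ => hfb x
  have s3 : Summable fun x => (p x).toReal * f x := summable_expect fun x _ => hfb x
  have s4 : Summable fun x => (p x).toReal * u x := summable_expect hu
  have key : (fun x => η * (1 + Real.exp (u x)) + (Real.exp (u x) - 1 - u x) / (2 * η)) =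
      fun x => (η - 1 / (2 * η)) + ((η + 1 / (2 * η)) * Real.exp (u x) +
        (-(1 / (2 * η))) * u x) := by
    funext x
    ring
  have s0 : Summable fun x => (p x).toReal * (η - 1 / (2 * η)) := (summable_toReal p).mul_right _
  have s1' : Summable fun x => (p x).toReal * ((η + 1 / (2 * η)) * Real.exp (u x)) :=
    (s1.mul_left (η + 1 / (2 * η))).congr fun x => by ring
  have s4' : Summable fun x => (p x).toReal * ((-(1 / (2 * η))) * u x) :=
    (s4.mul_left (-(1 / (2 * η)))).congr fun x => by ring
  have s5 : Summable fun x => (p x).toReal * ((η + 1 / (2 * η)) * Real.exp (u x) +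
      (-(1 / (2 * η))) * u x) := (s1'.add s4').congr fun x => by ring
  have hval : expect p (fun x => η * (1 + Real.exp (u x)) +
      (Real.exp (u x) - 1 - u x) / (2 * η)) = 2 * η - expect p u / (2 * η) := by
    rw [key, expect_add s0 s5, expect_add s1' s4', expect_const, expect_const_mul,
      expect_const_mul, hone]
    ring
  have hle : expect p (fun x => Real.exp (u x) * f x - f x) ≤
      expect p (fun x => η * (1 + Real.exp (u x)) + (Real.exp (u x) - 1 - u x) / (2 * η)) := by
    refine expect_le_expect ((s2.sub s3).congr fun x => by ring) ?_ fun x _ => ?_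
    · exact (s0.add s5).congr fun x => by ring
    · have := exp_sub_one_mul_le (u := u x) (hf0 x) (hf1 x) hη
      linarith
  rw [expect_sub s2 s3, hval, ← hq] at hle
  linarith

end ChangeOfMeasure

/-! ### Likelihood ratios of trajectories and histories -/

section LogLikelihood

variable {C S A : Type*} {H : ℕ}

/-- Policy and transitions are common to both laws and cancel; only the reward ratios accumulate. -/
lemma hasLogDensity_rollout {P : S → A → PMF S} {R R' : S → A → PMF unitInterval}
    {g : S → A → unitInterval → ℝ} (hR : ∀ s a, HasLogDensity (R s a) (R' s a) 0 (g s a))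
    (π : Policy S A) :
    ∀ n s, HasLogDensity (rollout P R π n s) (rollout P R' π n s) 0 (stepSum g)
  | 0, s => by
      intro τ
      by_cases hτ : τ = ⟨[], s⟩
      · simp [rollout, hτ, stepSum]
      · simp [rollout, hτ]
  | n + 1, s => by
      refine HasLogDensity.bind_right fun a => (hR s a).bind fun r =>
        HasLogDensity.bind_right fun s' => ?_
      have ih := (hasLogDensity_rollout hR π (P := P) n s').add_const (g s a r)
      rw [add_zero] at ih
      exact ih.map fun τ => by simp [stepSum]

/-- The learner's own randomization is a common kernel given the history, so it cancels as well and
any adaptive learner is covered. -/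
lemma hasLogDensity_runLaw {E E' : CMDP C S A H} (hctx : E'.ctxLaw = E.ctxLaw)
    (hdyn : E'.dyn = E.dyn) {g : C → S → A → unitInterval → ℝ}
    (hR : ∀ c s a, HasLogDensity (E.reward c s a) (E'.reward c s a) 0 (g c s a))
    (L : Learner C S A) :
    ∀ t, HasLogDensity (E.runLaw L t) (E'.runLaw L t) 0
      fun h => (h.map fun e => stepSum (g e.ctx) e.traj).sum
  | 0 => by
      intro h
      by_cases hh : h = []
      · simp [CMDP.runLaw, hh]
      · simp [CMDP.runLaw, hh]
  | t + 1 => by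
      rw [CMDP.runLaw, CMDP.runLaw, hctx]
      refine (hasLogDensity_runLaw hctx hdyn hR L t).bind fun h =>
        HasLogDensity.bind_right fun c => HasLogDensity.bind_right fun π => ?_
      have ih := (hasLogDensity_rollout (P := (E.dyn c).trans) (hR c) π H
        (E.dyn c).start).add_const (h.map fun e => stepSum (g e.ctx) e.traj).sum
      rw [add_zero] at ih
      rw [CMDP.trajLaw, CMDP.trajLaw, hdyn]
      exact ih.map fun τ => by simp

end LogLikelihood

/-! ### Layers of equal size and the uniform dynamics -/

section Layers

/-- A partition of `S` into layers `0, …, H`, of which the first and the last one are singletons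
and the others have `M` elements. -/
structure Layering (S : Type*) [Fintype S] (H M : ℕ) where
  layer : S → ℕ
  start : S
  final : S
  layer_le : ∀ s, layer s ≤ H
  layer_eq_zero_iff : ∀ s, layer s = 0 ↔ s = start
  layer_eq_horizon_iff : ∀ s, layer s = H ↔ s = final
  card_layer : ∀ l, 0 < l → l < H → (Finset.univ.filter fun s => layer s = l).card = M

/-- The layer of a state: `none` is the start and `some none` the final state. -/
def gridLayer (H M : ℕ) : Option (Option (Fin (H - 1) × Fin M)) → ℕ
  | none => 0
  | some none => H
  | some (some x) => x.1 + 1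

lemma nonempty_layering {S : Type*} [Fintype S] {H M : ℕ} (hH : 2 ≤ H)
    (hS : Fintype.card S = M * (H - 1) + 2) : Nonempty (Layering S H M) := by
  classical
  have e : S ≃ Option (Option (Fin (H - 1) × Fin M)) := Fintype.equivOfCardEq (by
    simp [hS, mul_comm])
  refine ⟨⟨fun s => gridLayer H M (e s), e.symm none, e.symm (some none), ?_, ?_, ?_, ?_⟩⟩
  · intro s
    rcases e s with _ | _ | ⟨i, j⟩ <;> simp only [gridLayer] <;> omega
  · intro s
    rw [Equiv.eq_symm_apply]
    rcases e s with _ | _ | ⟨i, j⟩ <;> simp [gridLayer]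
    omega
  · intro s
    rw [Equiv.eq_symm_apply]
    rcases e s with _ | _ | ⟨i, j⟩ <;> simp [gridLayer] <;> omega
  · intro l h0 hl
    have : (Finset.univ.filter fun s => gridLayer H M (e s) = l) =
        Finset.univ.image fun j : Fin M => e.symm (some (some (⟨l - 1, by omega⟩, j))) := by
      ext s
      simp only [Finset.mem_filter, Finset.mem_univ, true_and, Finset.mem_image,
        Equiv.symm_apply_eq]
      rcases e s with _ | _ | ⟨i, j⟩
      · simp only [gridLayer]
        constructor
        · omega
        · simp
      · simp only [gridLayer]
        constructor
        · omega
        · simp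
      · simp only [gridLayer, Option.some.injEq, Prod.mk.injEq, Fin.ext_iff, exists_and_left]
        constructor
        · intro h
          exact ⟨by omega, j, rfl⟩
        · rintro ⟨h, -⟩
          omega
    rw [this, Finset.card_image_of_injective, Finset.card_univ, Fintype.card_fin]
    intro j j' h
    simpa using h

namespace Layering

variable {S : Type*} [Fintype S] {H M : ℕ} (Λ : Layering S H M)

/-- The uniform law on the layer `l`. -/
def law (l : ℕ) : PMF S :=
  if h : (Finset.univ.filter fun s => Λ.layer s = l).Nonempty then PMF.uniformOfFinset _ h
  -- Default for an empty layer. When `M ≥ 1` this happens only beyond `H`, that is, for transitions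
  -- out of the final state.
  else PMF.pure Λ.final

/-- The states of the layers other than the first and the last one. -/
def inner : Finset S :=
  Finset.univ.filter fun s => 0 < Λ.layer s ∧ Λ.layer s < H

variable {Λ}

lemma layer_nonempty (hM : 1 ≤ M) {l : ℕ} (hl : l ≤ H) :
    (Finset.univ.filter fun s => Λ.layer s = l).Nonempty := by
  rcases Nat.eq_zero_or_pos l with rfl | h0
  · exact ⟨Λ.start, by simp [Λ.layer_eq_zero_iff]⟩
  rcases hl.eq_or_lt with rfl | h1
  · exact ⟨Λ.final, by simp [Λ.layer_eq_horizon_iff]⟩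
  · rw [← Finset.card_pos, Λ.card_layer l h0 h1]
    exact hM

lemma law_eq (hM : 1 ≤ M) {l : ℕ} (hl : l ≤ H) :
    Λ.law l = PMF.uniformOfFinset _ (layer_nonempty (Λ := Λ) hM hl) :=
  dif_pos _

lemma mem_support_law (hM : 1 ≤ M) {l : ℕ} (hl : l ≤ H) {s : S} :
    s ∈ (Λ.law l).support ↔ Λ.layer s = l := by
  rw [law_eq hM hl, PMF.support_uniformOfFinset]
  simp

lemma law_zero (hM : 1 ≤ M) : Λ.law 0 = PMF.pure Λ.start := by
  classical
  have h : (Finset.univ.filter fun s => Λ.layer s = 0) = {Λ.start} := by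
    ext s
    simp [Λ.layer_eq_zero_iff]
  rw [law_eq hM (Nat.zero_le H)]
  ext s
  rw [PMF.uniformOfFinset_apply, h]
  simp [PMF.pure_apply]

lemma toReal_law (hM : 1 ≤ M) {l : ℕ} (h0 : 0 < l) (hl : l < H) (s : S) :
    (Λ.law l s).toReal = if Λ.layer s = l then (M : ℝ)⁻¹ else 0 := by
  rw [law_eq hM hl.le, PMF.uniformOfFinset_apply, Λ.card_layer l h0 hl]
  split_ifs with h1 h2 h2 <;> simp_all

lemma inv_le_toReal_law (hM : 1 ≤ M) (s : S) :
    (M : ℝ)⁻¹ ≤ (Λ.law (Λ.layer s) s).toReal := by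
  have hM1 : (M : ℝ)⁻¹ ≤ 1 := inv_le_one_of_one_le₀ (by exact_mod_cast hM)
  rcases Nat.eq_zero_or_pos (Λ.layer s) with h0 | h0
  · rw [h0, law_zero hM, (Λ.layer_eq_zero_iff s).1 h0]
    simpa using hM1
  rcases (Λ.layer_le s).eq_or_lt with h1 | h1
  · have hs := (Λ.layer_eq_horizon_iff s).1 h1
    have h : (Finset.univ.filter fun t => Λ.layer t = Λ.layer s) = {s} := by
      ext t
      rw [h1, Finset.mem_filter, Λ.layer_eq_horizon_iff, Finset.mem_singleton, hs]
      simp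
    rw [law_eq hM (Λ.layer_le s), PMF.uniformOfFinset_apply, h]
    simpa using hM1
  · rw [toReal_law hM h0 h1, if_pos rfl]

/-- Times `0, …, H - 1` pass through the start and then the inner layers, where each state has
weight `1 / M`; the final state is never counted. -/
lemma sum_expect_law (hM : 1 ≤ M) (hH : 1 ≤ H) (F : S → ℝ) :
    ∑ j ∈ Finset.range H, expect (Λ.law j) F =
      F Λ.start + (M : ℝ)⁻¹ * ∑ s ∈ Λ.inner, F s := by
  have h1 : ∑ s ∈ Λ.inner, F s =
      ∑ l ∈ Finset.Ico 1 H, ∑ s ∈ Λ.inner with Λ.layer s = l, F s :=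
    (Finset.sum_fiberwise_of_maps_to (fun s hs => by
      simp only [inner, Finset.mem_filter] at hs
      simp only [Finset.mem_Ico]
      omega) F).symm
  rw [Finset.range_eq_Ico, Finset.sum_eq_sum_Ico_succ_bot (by omega), law_zero hM, expect_pure, h1,
    Finset.mul_sum]
  congr 1
  refine Finset.sum_congr rfl fun l hl => ?_
  rw [Finset.mem_Ico] at hl
  rw [expect_eq_sum, Finset.mul_sum, Finset.sum_filter, inner, Finset.sum_filter]
  refine Finset.sum_congr rfl fun s _ => ?_
  rw [toReal_law hM (by omega) (by omega)]
  by_cases h : Λ.layer s = l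
  · simp [h]
    omega
  · simp [h]

lemma card_inner : (Λ.inner.card : ℝ) = M * ((H - 1 : ℕ) : ℝ) := by
  have : Λ.inner.card = M * (H - 1) := by
    rw [Finset.card_eq_sum_card_fiberwise (f := Λ.layer) (t := Finset.Ico 1 H) fun s hs => by
      simp only [inner, Finset.coe_filter, Set.mem_ofPred_eq] at hs
      simp only [Finset.coe_Ico, Set.mem_Ico]
      omega]
    have : ∀ l ∈ Finset.Ico 1 H, (Λ.inner.filter fun s => Λ.layer s = l).card = M := by
      intro l hl
      rw [Finset.mem_Ico] at hl
      refine Eq.trans ?_ (Λ.card_layer l (by omega) (by omega))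
      rw [inner, Finset.filter_filter]
      congr 1
      refine Finset.filter_congr fun s _ => ?_
      omega
    rw [Finset.sum_congr rfl this]
    simp [mul_comm]
  exact_mod_cast this

variable (Λ)

/-- The dynamics which moves from each layer to a uniform state of the next one. -/
def dynamics (A : Type*) (hM : 1 ≤ M) : LayeredDynamics S A H where
  trans s _ := Λ.law (Λ.layer s + 1)
  start := Λ.start
  final := Λ.final
  layer := Λ.layer
  layer_le := Λ.layer_le
  layer_eq_zero_iff := Λ.layer_eq_zero_iff
  layer_eq_horizon_iff := Λ.layer_eq_horizon_iff
  layer_succ s _ s' hs hs' := by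
    have h : Λ.layer s ≠ H := fun h => hs ((Λ.layer_eq_horizon_iff s).1 h)
    have h' := Λ.layer_le s
    exact (mem_support_law hM (by omega)).1 hs'

variable {Λ}

lemma stateLaw_dynamics {A : Type*} (hM : 1 ≤ M) (π : Policy S A) :
    ∀ h ≤ H, stateLaw (Λ.dynamics A hM).trans π Λ.start h = Λ.law h
  | 0, _ => by rw [stateLaw, law_zero hM]
  | h + 1, hh => by
      have hc : ∀ s ∈ (Λ.law h).support, Λ.law (Λ.layer s + 1) = Λ.law (h + 1) := fun s hs => by
        rw [(mem_support_law hM (by omega)).1 hs]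
      rw [stateLaw, stateLaw_dynamics hM π h (by omega)]
      simp only [dynamics, PMF.bind_const]
      ext y
      rw [PMF.bind_apply]
      calc ∑' s, Λ.law h s * Λ.law (Λ.layer s + 1) y
          = ∑' s, Λ.law h s * Λ.law (h + 1) y := by
            refine tsum_congr fun s => ?_
            by_cases hs : s ∈ (Λ.law h).support
            · rw [hc s hs]
            · rw [PMF.mem_support_iff, not_not] at hs
              simp [hs]
        _ = Λ.law (h + 1) y := by rw [ENNReal.tsum_mul_right, PMF.tsum_coe, one_mul]

lemma minReachable_dynamics (A : Type*) (hM : 1 ≤ M) :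
    (Λ.dynamics A hM).MinReachable (M : ℝ)⁻¹ := by
  intro π s
  change _ ≤ (stateLaw (Λ.dynamics A hM).trans π Λ.start (Λ.layer s) s).toReal
  rw [stateLaw_dynamics hM π _ (Λ.layer_le s)]
  exact inv_le_toReal_law hM s

end Layering

end Layers

/-! ### Bernoulli rewards -/

section Coin

/-- The Bernoulli law on `Bool`. -/
def boolLaw (q : unitInterval) : PMF Bool :=
  PMF.ofFintype (fun b => ENNReal.ofReal (if b then (q : ℝ) else 1 - q)) (by
    have h0 := q.2.1
    have h1 := q.2.2
    simp only [Fintype.sum_bool, if_true, Bool.false_eq_true, if_false]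
    rw [← ENNReal.ofReal_add h0 (by linarith)]
    simp)

/-- The Bernoulli law of mean `q` on `{0, 1} ⊆ [0, 1]`. -/
def coin (q : unitInterval) : PMF unitInterval :=
  (boolLaw q).map fun b => if b then 1 else 0

lemma expect_boolLaw (q : unitInterval) (f : Bool → ℝ) :
    expect (boolLaw q) f = q * f true + (1 - q) * f false := by
  have h0 := q.2.1
  have h1 := q.2.2
  rw [expect_eq_sum, Fintype.sum_bool]
  simp only [boolLaw, PMF.ofFintype_apply, if_true, Bool.false_eq_true, if_false]
  rw [ENNReal.toReal_ofReal h0, ENNReal.toReal_ofReal (by linarith)]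

lemma expect_coin (q : unitInterval) (f : unitInterval → ℝ) :
    expect (coin q) f = q * f 1 + (1 - q) * f 0 := by
  rw [coin, expect_map (B := max |f 1| |f 0|), expect_boolLaw]
  · simp
  · rintro (_ | _) _ <;> simp

lemma expect_coin_val (q : unitInterval) : expect (coin q) (fun r => (r : ℝ)) = q := by
  simp [expect_coin]

lemma hasLogDensity_coin {q q' : unitInterval} {u : unitInterval → ℝ}
    (h1 : (q' : ℝ) = q * Real.exp (u 1)) (h0 : 1 - (q' : ℝ) = (1 - q) * Real.exp (u 0)) :
    HasLogDensity (coin q) (coin q') 0 u := by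
  have hq0 := q.2.1
  have hq1 := q.2.2
  have h : HasLogDensity (boolLaw q) (boolLaw q') 0 fun b => u (if b then 1 else 0) := by
    rintro (_ | _) <;>
      simp only [boolLaw, PMF.ofFintype_apply, if_true, Bool.false_eq_true, if_false, Real.exp_zero,
        ENNReal.ofReal_one, mul_one]
    · rw [h0, ENNReal.ofReal_mul (by linarith)]
    · rw [h1, ENNReal.ofReal_mul hq0]
  exact h.map fun b => rfl

end Coin

/-! ### Bounds on values and play probabilities -/

section Bounds

variable {C S A : Type*} {H M : ℕ}

lemma final_notMem_inner [Fintype S] {Λ : Layering S H M} : Λ.final ∉ Λ.inner := by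
  have := (Λ.layer_eq_horizon_iff Λ.final).2 rfl
  simp [Layering.inner, this]

lemma ne_final_of_mem_inner [Fintype S] {Λ : Layering S H M} {s : S} (hs : s ∈ Λ.inner) :
    s ≠ Λ.final :=
  fun h => final_notMem_inner (h ▸ hs)

lemma start_notMem_inner [Fintype S] {Λ : Layering S H M} : Λ.start ∉ Λ.inner := by
  have := (Λ.layer_eq_zero_iff Λ.start).2 rfl
  simp [Layering.inner, this]

lemma start_ne_final [Fintype S] (Λ : Layering S H M) (hH : 1 ≤ H) : Λ.start ≠ Λ.final := by
  intro h
  have h0 := (Λ.layer_eq_zero_iff Λ.start).2 rfl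
  have h1 := (Λ.layer_eq_horizon_iff Λ.start).2 h
  omega

lemma expect_uniform [Fintype C] [Nonempty C] (f : C → ℝ) :
    expect (PMF.uniformOfFintype C) f = (Fintype.card C : ℝ)⁻¹ * ∑ c, f c := by
  rw [expect_eq_sum, Finset.mul_sum]
  simp

lemma abs_meanReward_le (E : CMDP C S A H) (c : C) (s : S) (a : A) :
    |E.meanReward c s a| ≤ 1 :=
  abs_expect_le fun r _ => by
    rw [abs_of_nonneg r.2.1]
    exact r.2.2

lemma abs_value_le (E : CMDP C S A H) (c : C) (π : Policy S A) : |E.value c π| ≤ H := by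
  refine abs_expect_le fun τ hτ => ?_
  have := abs_stepSum_le (g := fun s a _ => E.meanReward c s a)
    (fun s a _ => abs_meanReward_le E c s a) hτ
  simpa [stepSum] using this

lemma value_le_optValue (E : CMDP C S A H) (c : C) (π : Policy S A) :
    E.value c π ≤ E.optValue c := by
  refine le_ciSup (f := E.value c) ⟨H, ?_⟩ π
  rintro _ ⟨π', rfl⟩
  exact (abs_le.1 (abs_value_le E c π')).2

lemma abs_optValue_le [Nonempty A] (E : CMDP C S A H) (c : C) : |E.optValue c| ≤ H := by
  obtain ⟨a⟩ := ‹Nonempty A›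
  have : Nonempty (Policy S A) := ⟨fun _ => PMF.pure a⟩
  rw [abs_le]
  exact ⟨(abs_le.1 (abs_value_le E c fun _ => PMF.pure a)).1.trans (value_le_optValue E c _),
    ciSup_le fun π => (abs_le.1 (abs_value_le E c π)).2⟩

lemma sum_toReal [Fintype A] (p : PMF A) : ∑ a, (p a).toReal = 1 := by
  rw [← tsum_toReal p, tsum_fintype]

lemma toReal_le_one (p : PMF A) (a : A) : (p a).toReal ≤ 1 :=
  ENNReal.toReal_le_of_le_ofReal zero_le_one (by simpa using p.coe_le_one a)

/-- The probability with which the learner, after the history `h` and in the context `c`, plays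
the action `a` at the state `s`. -/
def playProb (L : Learner C S A) (c : C) (s : S) (a : A) (h : List (Episode C S A)) : ℝ :=
  expect (L h c) fun π => (π s a).toReal

lemma playProb_nonneg (L : Learner C S A) (c : C) (s : S) (a : A) (h : List (Episode C S A)) :
    0 ≤ playProb L c s a h :=
  expect_nonneg fun _ => ENNReal.toReal_nonneg

lemma playProb_le_one (L : Learner C S A) (c : C) (s : S) (a : A) (h : List (Episode C S A)) :
    playProb L c s a h ≤ 1 :=
  expect_le_of_le (fun _ => ENNReal.toReal_nonneg) fun π => toReal_le_one (π s) a

lemma abs_playProb_le (L : Learner C S A) (c : C) (s : S) (a : A) (h : List (Episode C S A)) :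
    |playProb L c s a h| ≤ 1 :=
  (abs_of_nonneg (playProb_nonneg L c s a h)).le.trans (playProb_le_one L c s a h)

lemma abs_toReal_le (π : Policy S A) (s : S) (a : A) : |(π s a).toReal| ≤ 1 :=
  (abs_of_nonneg ENNReal.toReal_nonneg).le.trans (toReal_le_one (π s) a)

lemma sum_playProb [Fintype A] (L : Learner C S A) (c : C) (s : S) (h : List (Episode C S A)) :
    ∑ a, playProb L c s a h = 1 := by
  simp only [playProb]
  rw [← expect_sum _ fun a _ => summable_expect (B := 1) fun π _ => abs_toReal_le π s a]
  simp [sum_toReal, expect_const]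

lemma sum_expect_playProb [Fintype A] (L : Learner C S A) (c : C) (s : S)
    (p : PMF (List (Episode C S A))) : ∑ a, expect p (playProb L c s a) = 1 := by
  rw [← expect_sum _ fun a _ => summable_expect (B := 1) fun h _ => abs_playProb_le L c s a h]
  simp [sum_playProb, expect_const]

end Bounds

/-! ### The hard instances and their regret -/

section HardInstance

variable {C S A : Type*} [Fintype C] [Nonempty C] [Fintype S] [DecidableEq S] [DecidableEq A]
  {H M : ℕ}

/-- The mean reward `1 / 2`, increased by `ε` if `b` holds. -/
def bonusMean (ε : Set.Icc (0 : ℝ) (1 / 4)) (b : Prop) [Decidable b] : unitInterval :=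
  ⟨1 / 2 + if b then (ε : ℝ) else 0, by
    have h0 := ε.2.1
    have h1 := ε.2.2
    constructor <;> split_ifs <;> linarith⟩

/-- The instance in which `Φ (s, c)`, if there is one, is the best action at the state `s` in the
context `c`. Rewards are Bernoulli, the contexts are uniform. -/
def hardCMDP (C : Type*) {A : Type*} [Fintype C] [Nonempty C] [DecidableEq A]
    (Λ : Layering S H M) (hM : 1 ≤ M) (ε : Set.Icc (0 : ℝ) (1 / 4))
    (Φ : S × C → Option A) : CMDP C S A H where
  ctxLaw := PMF.uniformOfFintype C
  dyn _ := Λ.dynamics A hM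
  reward c s a := if s = Λ.final then PMF.pure 0 else coin (bonusMean ε (Φ (s, c) = some a))
  reward_final _ _ := if_pos rfl

variable {Λ : Layering S H M} {hM : 1 ≤ M} {ε : Set.Icc (0 : ℝ) (1 / 4)}

lemma expect_trajLaw_hardCMDP (hH : 1 ≤ H) (Φ : S × C → Option A) (c : C) (π : Policy S A)
    {g : S → A → unitInterval → ℝ} {B : ℝ} (hg : ∀ s a r, |g s a r| ≤ B) :
    expect ((hardCMDP C Λ hM ε Φ).trajLaw c π) (stepSum g) =
      (expect (π Λ.start) fun a => expect ((hardCMDP C Λ hM ε Φ).reward c Λ.start a)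
        (g Λ.start a)) + (M : ℝ)⁻¹ * ∑ s ∈ Λ.inner,
          expect (π s) fun a => expect ((hardCMDP C Λ hM ε Φ).reward c s a) (g s a) := by
  have h := expect_rollout_of_layered (H := H) hg (R := (hardCMDP C Λ hM ε Φ).reward c) (π := π)
    (ν := Λ.law) (lay := Λ.layer)
    (fun l hl s hs => (Layering.mem_support_law hM hl.le).1 hs) H 0 (by omega)
  rw [Layering.law_zero hM, expect_pure] at h
  simp only [Nat.zero_add] at h
  rw [Layering.sum_expect_law hM hH] at h
  exact h

lemma meanReward_hardCMDP (Φ : S × C → Option A) (c : C) {s : S} (hs : s ≠ Λ.final) (a : A) :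
    (hardCMDP C Λ hM ε Φ).meanReward c s a = bonusMean ε (Φ (s, c) = some a) := by
  simp only [CMDP.meanReward, hardCMDP, if_neg hs, expect_coin_val]

variable [Fintype A]

lemma expect_bonusMean (p : PMF A) (b : A) :
    expect p (fun a => ((bonusMean ε (some b = some a) : unitInterval) : ℝ)) =
      1 / 2 + ε * (p b).toReal := by
  simp only [bonusMean, Option.some.injEq]
  rw [expect_add (summable_expect fun _ _ => le_rfl)
    (summable_expect (B := |(ε : ℝ)|) fun a _ => by split_ifs <;> simp), expect_const,
    expect_eq_sum]
  simp [mul_comm]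

lemma value_hardCMDP (hH : 1 ≤ H) (φ : S × C → A) (c : C) (π : Policy S A) :
    (hardCMDP C Λ hM ε fun x => some (φ x)).value c π =
      1 / 2 + ε * (π Λ.start (φ (Λ.start, c))).toReal + (M : ℝ)⁻¹ * ∑ s ∈ Λ.inner,
        (1 / 2 + ε * (π s (φ (s, c))).toReal) := by
  have h := expect_trajLaw_hardCMDP (ε := ε) (Λ := Λ) (hM := hM) hH (fun x => some (φ x)) c π
    (g := fun s a _ => (hardCMDP C Λ hM ε fun x => some (φ x)).meanReward c s a)
    fun s a _ => abs_meanReward_le _ c s a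
  simp only [expect_const] at h
  refine h.trans ?_
  congr 1
  · rw [← expect_bonusMean]
    exact expect_congr fun a _ => meanReward_hardCMDP _ c (start_ne_final Λ hH) a
  · congr 1
    refine Finset.sum_congr rfl fun s hs => ?_
    rw [← expect_bonusMean]
    exact expect_congr fun a _ => meanReward_hardCMDP _ c (ne_final_of_mem_inner hs) a

/-- The optimal value is bounded below by that of the policy that always plays `φ`; the nonnegative
loss at the start state is discarded. -/
lemma gap_le_optValue_sub_value (hH : 1 ≤ H) (φ : S × C → A) (c : C) (π : Policy S A) :
    (ε : ℝ) * (M : ℝ)⁻¹ * ∑ s ∈ Λ.inner, (1 - (π s (φ (s, c))).toReal) ≤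
      (hardCMDP C Λ hM ε fun x => some (φ x)).optValue c -
        (hardCMDP C Λ hM ε fun x => some (φ x)).value c π := by
  have h1 := value_le_optValue (hardCMDP C Λ hM ε fun x => some (φ x)) c
    fun s => PMF.pure (φ (s, c))
  rw [value_hardCMDP hH] at h1 ⊢
  simp only [PMF.pure_apply, if_true, ENNReal.toReal_one, mul_one] at h1
  have h2 := mul_nonneg ε.2.1 (sub_nonneg.2 (toReal_le_one (π Λ.start) (φ (Λ.start, c))))
  have h3 : (ε : ℝ) * (M : ℝ)⁻¹ * ∑ s ∈ Λ.inner, (1 - (π s (φ (s, c))).toReal) =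
      (M : ℝ)⁻¹ * ∑ s ∈ Λ.inner, (1 / 2 + (ε : ℝ)) -
        (M : ℝ)⁻¹ * ∑ s ∈ Λ.inner, (1 / 2 + ε * (π s (φ (s, c))).toReal) := by
    rw [← mul_sub, ← Finset.sum_sub_distrib, mul_comm (ε : ℝ), mul_assoc, Finset.mul_sum]
    congr 1
    exact Finset.sum_congr rfl fun s _ => by ring
  rw [h3]
  linarith

/-- Reduces regret to the probabilities of missing the secret action: an inner state in a given
context has weight `1 / (M |C|)` in every episode, whatever the learner does. -/
lemma gap_le_expectedRegret [Nonempty A] (hH : 1 ≤ H) (φ : S × C → A) (L : Learner C S A)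
    (T : ℕ) :
    (ε : ℝ) * (M : ℝ)⁻¹ * (Fintype.card C : ℝ)⁻¹ * ∑ t ∈ Finset.range T, ∑ c, ∑ s ∈ Λ.inner,
        (1 - expect ((hardCMDP C Λ hM ε fun x => some (φ x)).runLaw L t)
          (playProb L c s (φ (s, c)))) ≤
      (hardCMDP C Λ hM ε fun x => some (φ x)).expectedRegret L T := by
  set E := hardCMDP C Λ hM ε fun x => some (φ x) with hE
  have hb : ∀ c π, |E.optValue c - E.value c π| ≤ H + H := fun c π =>
    (abs_sub _ _).trans (add_le_add (abs_optValue_le E c) (abs_value_le E c π))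
  have h1 := expect_runLaw_sum (E := E) (L := L)
    (G := fun e => E.optValue e.ctx - E.value e.ctx e.policy) (fun c π _ _ => hb c π) T
  rw [CMDP.expectedRegret]
  refine le_of_le_of_eq ?_ h1.symm
  rw [Finset.mul_sum]
  refine Finset.sum_le_sum fun t _ => ?_
  have hq : ∀ (c : C) (s : S), ∀ h, |1 - playProb L c s (φ (s, c)) h| ≤ 1 := fun c s h => by
    have h0 := playProb_nonneg L c s (φ (s, c)) h
    have h1 := playProb_le_one L c s (φ (s, c)) h
    rw [abs_le]
    constructor <;> linarith
  have hsum : ∀ h, |∑ c, ∑ s ∈ Λ.inner, (1 - playProb L c s (φ (s, c)) h)| ≤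
      ∑ c : C, ∑ s ∈ Λ.inner, (1 : ℝ) := fun h =>
    (Finset.abs_sum_le_sum_abs _ _).trans (Finset.sum_le_sum fun c _ =>
      (Finset.abs_sum_le_sum_abs _ _).trans (Finset.sum_le_sum fun s _ => hq c s h))
  have hlhs : (ε : ℝ) * (M : ℝ)⁻¹ * (Fintype.card C : ℝ)⁻¹ * ∑ c, ∑ s ∈ Λ.inner,
        (1 - expect (E.runLaw L t) (playProb L c s (φ (s, c)))) =
      expect (E.runLaw L t) fun h => (ε : ℝ) * (M : ℝ)⁻¹ * (Fintype.card C : ℝ)⁻¹ *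
        ∑ c, ∑ s ∈ Λ.inner, (1 - playProb L c s (φ (s, c)) h) := by
    rw [expect_const_mul, expect_sum _ fun c _ => summable_expect (B := ∑ s ∈ Λ.inner, (1 : ℝ))
      fun h _ => (Finset.abs_sum_le_sum_abs _ _).trans (Finset.sum_le_sum fun s _ => hq c s h)]
    congr 1
    refine Finset.sum_congr rfl fun c _ => ?_
    rw [expect_sum _ fun s _ => summable_expect (B := 1) fun h _ => hq c s h]
    refine Finset.sum_congr rfl fun s _ => ?_
    rw [expect_sub (summable_expect fun _ _ => le_rfl)
      (summable_expect (B := 1) fun h _ => abs_playProb_le L c s _ h), expect_const]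
  rw [hlhs]
  refine expect_mono (B := |(ε : ℝ) * (M : ℝ)⁻¹ * (Fintype.card C : ℝ)⁻¹| *
      ∑ c : C, ∑ s ∈ Λ.inner, (1 : ℝ)) (B' := H + H) (fun h _ => ?_) (fun h _ => ?_)
    fun h _ => ?_
  · rw [abs_mul]
    exact mul_le_mul_of_nonneg_left (hsum h) (abs_nonneg _)
  · exact abs_nextMean_le (fun c π _ _ => hb c π) h
  · simp only [nextMean, expect_const]
    have hctx : E.ctxLaw = PMF.uniformOfFintype C := rfl
    rw [hctx, expect_uniform, mul_comm ((ε : ℝ) * (M : ℝ)⁻¹), mul_assoc, Finset.mul_sum]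
    refine mul_le_mul_of_nonneg_left (Finset.sum_le_sum fun c _ => ?_) (by positivity)
    have h2 : ∀ (π : Policy S A) (s : S), |1 - (π s (φ (s, c))).toReal| ≤ 1 := fun π s => by
      have h0 : 0 ≤ (π s (φ (s, c))).toReal := ENNReal.toReal_nonneg
      have h1 := toReal_le_one (π s) (φ (s, c))
      rw [abs_le]
      constructor <;> linarith
    have h3 : ∑ s ∈ Λ.inner, (1 - playProb L c s (φ (s, c)) h) =
        expect (L h c) fun π => ∑ s ∈ Λ.inner, (1 - (π s (φ (s, c))).toReal) := by
      rw [expect_sum _ fun s _ => summable_expect (B := 1) fun π _ => h2 π s]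
      refine Finset.sum_congr rfl fun s _ => ?_
      rw [expect_sub (summable_expect fun _ _ => le_rfl)
        (summable_expect (B := 1) fun π _ => abs_toReal_le π s _), expect_const, playProb]
    rw [h3, ← expect_const_mul]
    refine expect_mono (B := |(ε : ℝ) * (M : ℝ)⁻¹| * ∑ s ∈ Λ.inner, (1 : ℝ)) (B' := H + H)
      (fun π _ => ?_) (fun π _ => hb c π) fun π _ => gap_le_optValue_sub_value hH φ c π
    rw [abs_mul]
    exact mul_le_mul_of_nonneg_left ((Finset.abs_sum_le_sum_abs _ _).trans
      (Finset.sum_le_sum fun s _ => h2 π s)) (abs_nonneg _)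

end HardInstance

/-! ### Information about one pair of a state and a context -/

section Information

variable {C S A : Type*} [DecidableEq C] [DecidableEq S] [DecidableEq A]

open Classical in
/-- The log-likelihood ratio of a Bernoulli reward with mean `1 / 2 + ε` to one with mean `1 / 2`. -/
def logBonus (ε : ℝ) (r : unitInterval) : ℝ :=
  if r = 1 then Real.log (1 + 2 * ε) else Real.log (1 - 2 * ε)

lemma abs_logBonus_le (ε : ℝ) (r : unitInterval) :
    |logBonus ε r| ≤ max |Real.log (1 + 2 * ε)| |Real.log (1 - 2 * ε)| := by
  unfold logBonus
  split_ifs <;> simp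

/-- The right side is `log (1 - 4 ε²) / 2`. It is estimated by `log y ≥ 1 - 1 / y`, and `1 / (1 - 4
ε²) ≤ 1 + 6 ε²` because `ε² ≤ 1 / 16`. -/
lemma neg_sq_le_log {ε : ℝ} (h0 : 0 ≤ ε) (h1 : ε ≤ 1 / 4) :
    -(3 * ε ^ 2) ≤ 1 / 2 * Real.log (1 + 2 * ε) + 1 / 2 * Real.log (1 - 2 * ε) := by
  have hp : 0 < (1 + 2 * ε) * (1 - 2 * ε) := mul_pos (by linarith) (by linarith)
  have h := Real.one_sub_inv_le_log_of_pos hp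
  rw [Real.log_mul (by linarith) (by linarith)] at h
  have h2 : ((1 + 2 * ε) * (1 - 2 * ε))⁻¹ ≤ 1 + 6 * ε ^ 2 := by
    rw [inv_le_iff_one_le_mul₀ hp]
    nlinarith [mul_nonneg (sq_nonneg ε) (by nlinarith : 0 ≤ 1 / 16 - ε ^ 2)]
  linarith

/-- The log-likelihood ratio of a reward if `a` becomes the best action at `x`. -/
def logRatio (ε : ℝ) (x : S × C) (a : A) (c : C) (s : S) (b : A) (r : unitInterval) : ℝ :=
  if (s, c) = x ∧ b = a then logBonus ε r else 0

lemma abs_logRatio_le (ε : ℝ) (x : S × C) (a : A) (c : C) (s : S) (b : A) (r : unitInterval) :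
    |logRatio ε x a c s b r| ≤ max |Real.log (1 + 2 * ε)| |Real.log (1 - 2 * ε)| := by
  unfold logRatio
  split_ifs
  · exact abs_logBonus_le ε r
  · simp

variable [Fintype C] [Nonempty C] [Fintype S] {H M : ℕ} {Λ : Layering S H M} {hM : 1 ≤ M}
  {ε : Set.Icc (0 : ℝ) (1 / 4)}

lemma hasLogDensity_reward {Φ : S × C → Option A} {x : S × C} (hx : x.1 ≠ Λ.final) (a : A)
    (c : C) (s : S) (b : A) :
    HasLogDensity ((hardCMDP C Λ hM ε (Function.update Φ x none)).reward c s b)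
      ((hardCMDP C Λ hM ε (Function.update Φ x (some a))).reward c s b) 0
      (logRatio ε x a c s b) := by
  have hrefl : ∀ (p : PMF unitInterval) (u : unitInterval → ℝ), (∀ r, u r = 0) →
      HasLogDensity p p 0 u := fun p u hu r => by rw [hu]
  have h0 := ε.2.1
  have h1 := ε.2.2
  by_cases hs : s = Λ.final
  · have hne : (s, c) ≠ x := by
      rintro rfl
      exact hx hs
    simp only [hardCMDP, if_pos hs]
    exact hrefl _ _ fun r => if_neg fun h => hne h.1
  by_cases hsc : (s, c) = x
  · by_cases hb : b = a
    · simp only [hardCMDP, if_neg hs]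
      refine hasLogDensity_coin ?_ ?_
      · simp [bonusMean, logRatio, logBonus, hsc, hb]
        rw [Real.exp_log (by linarith)]
        ring
      · simp [bonusMean, logRatio, logBonus, hsc, hb]
        rw [Real.exp_log (by linarith)]
        ring
    · simp only [hardCMDP, if_neg hs]
      have : bonusMean ε (Function.update Φ x (some a) (s, c) = some b) =
          bonusMean ε (Function.update Φ x none (s, c) = some b) := by
        simp [bonusMean, hsc, Ne.symm hb]
      rw [this]
      exact hrefl _ _ fun r => if_neg fun h => hb h.2
  · simp only [hardCMDP, if_neg hs, Function.update_of_ne hsc]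
    exact hrefl _ _ fun r => if_neg fun h => hsc h.1

variable [Fintype A]

/-- Only the term of `s` survives in the layer decomposition, and only if the context is `c`; the
start state drops out since it is not inner. -/
lemma expect_trajLaw_logRatio (hH : 1 ≤ H) {Φ : S × C → Option A} {s : S} (hs : s ∈ Λ.inner)
    (c : C) (a : A) (c' : C) (π : Policy S A) :
    expect ((hardCMDP C Λ hM ε (Function.update Φ (s, c) none)).trajLaw c' π)
        (stepSum (logRatio ε (s, c) a c')) =
      if c' = c then (M : ℝ)⁻¹ * ((π s a).toReal *
        (1 / 2 * Real.log (1 + 2 * ε) + 1 / 2 * Real.log (1 - 2 * ε))) else 0 := by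
  rw [expect_trajLaw_hardCMDP hH _ c' π fun s' b r => abs_logRatio_le ε (s, c) a c' s' b r]
  have hz : ∀ s', (s', c') ≠ (s, c) → (expect (π s') fun b =>
      expect ((hardCMDP C Λ hM ε (Function.update Φ (s, c) none)).reward c' s' b)
        (logRatio ε (s, c) a c' s' b)) = 0 := fun s' h => by
    have : ∀ b, logRatio (ε : ℝ) (s, c) a c' s' b = fun _ => 0 := fun b => by
      funext r
      simp only [logRatio, h, false_and, if_false]
    simp only [this, expect_const]
  have hstart : (Λ.start, c') ≠ (s, c) := fun h => start_notMem_inner (Λ := Λ) (by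
    rw [(Prod.mk.inj h).1]
    exact hs)
  rw [hz _ hstart, zero_add]
  split_ifs with hc
  · subst hc
    rw [Finset.sum_eq_single_of_mem s hs fun s' _ hne => hz s' (by simp [hne])]
    congr 1
    rw [expect_eq_sum, Finset.sum_eq_single_of_mem a (Finset.mem_univ a)]
    · congr 1
      simp only [hardCMDP, if_neg (ne_final_of_mem_inner hs), expect_coin]
      simp [bonusMean, logRatio, logBonus]
      norm_num
    · intro b _ hb
      have : logRatio (ε : ℝ) (s, c') a c' s b = fun _ => 0 := by
        funext r
        simp only [logRatio, hb, and_false, if_false]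
      rw [this, expect_const, mul_zero]
  · rw [Finset.sum_eq_zero fun s' _ => hz s' (by simp [hc]), mul_zero]

/-- Up to sign, this is the relative entropy of the two histories: information arrives only when `a`
is played at `(s, c)`. -/
lemma expect_runLaw_logRatio (hH : 1 ≤ H) {Φ : S × C → Option A} {s : S} (hs : s ∈ Λ.inner)
    (c : C) (a : A) (L : Learner C S A) (t : ℕ) :
    expect ((hardCMDP C Λ hM ε (Function.update Φ (s, c) none)).runLaw L t)
        (fun h => (h.map fun e => stepSum (logRatio ε (s, c) a e.ctx) e.traj).sum) =
      (Fintype.card C : ℝ)⁻¹ * (M : ℝ)⁻¹ *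
        (1 / 2 * Real.log (1 + 2 * ε) + 1 / 2 * Real.log (1 - 2 * ε)) *
        ∑ i ∈ Finset.range t,
          expect ((hardCMDP C Λ hM ε (Function.update Φ (s, c) none)).runLaw L i)
            (playProb L c s a) := by
  rw [expect_runLaw_sum fun c' π τ hτ =>
    abs_stepSum_le (fun s' b r => abs_logRatio_le ε (s, c) a c' s' b r) hτ, Finset.mul_sum]
  refine Finset.sum_congr rfl fun i _ => ?_
  rw [← expect_const_mul]
  refine expect_congr fun h _ => ?_
  have hctx : (hardCMDP C Λ hM ε (Function.update Φ (s, c) none)).ctxLaw =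
    PMF.uniformOfFintype C := rfl
  rw [nextMean, hctx, expect_uniform, Finset.sum_eq_single_of_mem c (Finset.mem_univ c)]
  · have : ∀ π : Policy S A,
        (expect ((hardCMDP C Λ hM ε (Function.update Φ (s, c) none)).trajLaw c π)
          fun τ => stepSum (logRatio ε (s, c) a c) τ) = (M : ℝ)⁻¹ *
          (1 / 2 * Real.log (1 + 2 * ε) + 1 / 2 * Real.log (1 - 2 * ε)) * (π s a).toReal :=
      fun π => (expect_trajLaw_logRatio hH hs c a c π).trans (by rw [if_pos rfl]; ring)
    simp only [this]
    rw [expect_const_mul, playProb]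
    ring
  · intro c' _ hc
    have : ∀ π : Policy S A,
        (expect ((hardCMDP C Λ hM ε (Function.update Φ (s, c) none)).trajLaw c' π)
          fun τ => stepSum (logRatio ε (s, c) a c') τ) = 0 :=
      fun π => (expect_trajLaw_logRatio hH hs c a c' π).trans (if_neg hc)
    simp only [this, expect_const]

/-- Making `a` the best action at `(s, c)` increases the probability that it is played there by
little, unless it is played there often anyway. -/
lemma expect_playProb_le (hH : 1 ≤ H) {Φ : S × C → Option A} {s : S} (hs : s ∈ Λ.inner)
    (c : C) (a : A) (L : Learner C S A) (t : ℕ) :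
    expect ((hardCMDP C Λ hM ε (Function.update Φ (s, c) (some a))).runLaw L t)
        (playProb L c s a) ≤
      expect ((hardCMDP C Λ hM ε (Function.update Φ (s, c) none)).runLaw L t)
        (playProb L c s a) + 1 / 8 +
      24 * (ε : ℝ) ^ 2 * ((Fintype.card C : ℝ)⁻¹ * (M : ℝ)⁻¹) * ∑ i ∈ Finset.range t,
        expect ((hardCMDP C Λ hM ε (Function.update Φ (s, c) none)).runLaw L i)
          (playProb L c s a) := by
  have hd := hasLogDensity_runLaw (E := hardCMDP C Λ hM ε (Function.update Φ (s, c) none))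
    (E' := hardCMDP C Λ hM ε (Function.update Φ (s, c) (some a))) rfl rfl
    (fun c' s' b => hasLogDensity_reward (ne_final_of_mem_inner hs) a c' s' b) L t
  -- With this `η`, the additive error `2 η` is `1 / 8`, and the factor `1 / (2 η) = 8` turns `3 ε²`
  -- into `24 ε²`.
  have h := hd.expect_le (η := 1 / 16) (abs_sum_runLaw_le (fun c' π τ hτ =>
    abs_stepSum_le (fun s' b r => abs_logRatio_le ε (s, c) a c' s' b r) hτ) t)
    (playProb_nonneg L c s a) (playProb_le_one L c s a) (by norm_num)
  rw [expect_runLaw_logRatio hH hs c a L t] at h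
  have hk := neg_sq_le_log ε.2.1 ε.2.2
  have hn : 0 ≤ ((Fintype.card C : ℝ)⁻¹ * (M : ℝ)⁻¹) * ∑ i ∈ Finset.range t,
      expect ((hardCMDP C Λ hM ε (Function.update Φ (s, c) none)).runLaw L i)
        (playProb L c s a) :=
    mul_nonneg (by positivity)
      (Finset.sum_nonneg fun i _ => expect_nonneg (playProb_nonneg L c s a))
  have hm := mul_le_mul_of_nonneg_right hk hn
  refine h.trans (le_of_sub_nonneg ?_)
  ring_nf at hm ⊢
  linarith

/-- The reference instance does not depend on `a`, so its play probabilities sum to `1` in each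
episode. The three contributions are thus `1 ≤ |A| / 2`, `|A| / 8` and, by the choice of `ε`, at
most `|A| / 8`. -/
lemma sum_expect_playProb_le (hH : 1 ≤ H) {Φ : S × C → Option A} {s : S} (hs : s ∈ Λ.inner)
    (c : C) (L : Learner C S A) {t T : ℕ} (ht : t ≤ T) (hA : 2 ≤ Fintype.card A)
    (hε : 24 * (ε : ℝ) ^ 2 * ((Fintype.card C : ℝ)⁻¹ * (M : ℝ)⁻¹) * T ≤ Fintype.card A / 8) :
    ∑ a, expect ((hardCMDP C Λ hM ε (Function.update Φ (s, c) (some a))).runLaw L t)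
        (playProb L c s a) ≤ 3 / 4 * Fintype.card A := by
  refine (Finset.sum_le_sum fun a _ => expect_playProb_le hH hs c a L t).trans ?_
  rw [Finset.sum_add_distrib, Finset.sum_add_distrib, sum_expect_playProb, ← Finset.mul_sum,
    Finset.sum_comm]
  simp only [sum_expect_playProb]
  simp only [Finset.sum_const, Finset.card_univ, Finset.card_range, nsmul_eq_mul, mul_one]
  have hA' : (2 : ℝ) ≤ Fintype.card A := by exact_mod_cast hA
  have hmono : 24 * (ε : ℝ) ^ 2 * ((Fintype.card C : ℝ)⁻¹ * (M : ℝ)⁻¹) * t ≤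
      24 * (ε : ℝ) ^ 2 * ((Fintype.card C : ℝ)⁻¹ * (M : ℝ)⁻¹) * T := by
    gcongr
  linarith

end Information

/-! ### Averaging over the secret actions -/

section Averaging

/-- Resampling one coordinate does not change an average. -/
lemma sum_sum_update {X A : Type*} [Fintype X] [DecidableEq X] [Fintype A]
    (x : X) (F : (X → A) → ℝ) :
    ∑ φ : X → A, ∑ a, F (Function.update φ x a) = Fintype.card A * ∑ φ, F φ := by
  -- Exchanging the value at `x` with the spare action is an involution, hence a bijection of the
  -- index set.
  let e : (X → A) × A ≃ (X → A) × A := Function.Involutive.toPerm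
    (fun z => (Function.update z.1 x z.2, z.1 x)) fun z => by simp
  have h := Equiv.sum_comp e fun z => F z.1
  rw [Fintype.sum_prod_type, Fintype.sum_prod_type] at h
  refine h.trans ?_
  simp [Finset.mul_sum]

/-- The class of the functions `1 / 2 + ε 1{a = φ c}`. -/
def bonusClass (C A : Type*) [Fintype C] [Fintype A] [DecidableEq C] [DecidableEq A]
    (ε : Set.Icc (0 : ℝ) (1 / 4)) : Finset (C → A → unitInterval) :=
  open Classical in
  Finset.univ.image fun (φ : C → A) c a => bonusMean ε (some (φ c) = some a)

lemma card_bonusClass_le {C A : Type*} [Fintype C] [Fintype A] [DecidableEq C] [DecidableEq A]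
    {ε : Set.Icc (0 : ℝ) (1 / 4)} :
    (bonusClass C A ε).card ≤ Fintype.card A ^ Fintype.card C := by
  refine Finset.card_image_le.trans ?_
  rw [Finset.card_univ, Fintype.card_fun]

variable {C S A : Type*} [Fintype C] [Nonempty C] [Fintype S] [Fintype A] [DecidableEq C]
  [DecidableEq S] [DecidableEq A] {H M : ℕ} {Λ : Layering S H M} {hM : 1 ≤ M}
  {ε : Set.Icc (0 : ℝ) (1 / 4)}

/-- The coordinate `φ (s, c)` is resampled with the others held fixed, which reduces the average
over `φ` to the one over the best action at `(s, c)`. -/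
lemma sum_expect_playProb_best_le (hH : 1 ≤ H) {s : S} (hs : s ∈ Λ.inner) (c : C)
    (L : Learner C S A) {t T : ℕ} (ht : t ≤ T) (hA : 2 ≤ Fintype.card A)
    (hε : 24 * (ε : ℝ) ^ 2 * ((Fintype.card C : ℝ)⁻¹ * (M : ℝ)⁻¹) * T ≤ Fintype.card A / 8) :
    ∑ φ : S × C → A, expect ((hardCMDP C Λ hM ε fun x => some (φ x)).runLaw L t)
        (playProb L c s (φ (s, c))) ≤ 3 / 4 * Fintype.card (S × C → A) := by
  have h1 := sum_sum_update (s, c) fun φ : S × C → A =>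
    expect ((hardCMDP C Λ hM ε fun x => some (φ x)).runLaw L t) (playProb L c s (φ (s, c)))
  have h2 : ∀ φ : S × C → A, ∑ a, expect ((hardCMDP C Λ hM ε fun x =>
      some (Function.update φ (s, c) a x)).runLaw L t)
        (playProb L c s (Function.update φ (s, c) a (s, c))) ≤ 3 / 4 * Fintype.card A := by
    intro φ
    have h3 : ∀ a, (fun x => some (Function.update φ (s, c) a x)) =
        Function.update (fun x => some (φ x)) (s, c) (some a) := fun a =>
      Function.comp_update some φ (s, c) a
    simp only [h3, Function.update_self]
    exact sum_expect_playProb_le hH hs c L ht hA hε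
  have h4 := Finset.sum_le_sum fun φ (_ : φ ∈ Finset.univ) => h2 φ
  rw [h1, Finset.sum_const, Finset.card_univ, nsmul_eq_mul] at h4
  have hA' : (0 : ℝ) < Fintype.card A := by
    have : 0 < Fintype.card A := by omega
    exact_mod_cast this
  refine le_of_mul_le_mul_left ?_ hA'
  linarith

/-- For a suitable choice of the best actions, the learner errs with constant probability. -/
lemma exists_expectedRegret_ge (hH : 1 ≤ H) (hM : 1 ≤ M) (L : Learner C S A) {T : ℕ}
    (hA : 2 ≤ Fintype.card A)
    (hε : 24 * (ε : ℝ) ^ 2 * ((Fintype.card C : ℝ)⁻¹ * (M : ℝ)⁻¹) * T ≤ Fintype.card A / 8) :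
    ∃ φ : S × C → A, (ε : ℝ) * T * ((H - 1 : ℕ) : ℝ) / 4 ≤
      (hardCMDP C Λ hM ε fun x => some (φ x)).expectedRegret L T := by
  have : Nonempty A := Fintype.card_pos_iff.1 (by omega)
  have hK : (Fintype.card C : ℝ) ≠ 0 := by exact_mod_cast Fintype.card_ne_zero
  have hM0 : (M : ℝ) ≠ 0 := by
    have : M ≠ 0 := by omega
    exact_mod_cast this
  have key : ∑ φ : S × C → A, (ε : ℝ) * T * ((H - 1 : ℕ) : ℝ) / 4 ≤
      ∑ φ : S × C → A, (hardCMDP C Λ hM ε fun x => some (φ x)).expectedRegret L T := by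
    refine le_trans ?_ (Finset.sum_le_sum fun φ _ => gap_le_expectedRegret hH φ L T)
    rw [← Finset.mul_sum, Finset.sum_comm]
    have h1 : ∀ t ∈ Finset.range T, 1 / 4 * Fintype.card (S × C → A) *
        ((Fintype.card C : ℝ) * (M * ((H - 1 : ℕ) : ℝ))) ≤
        ∑ φ : S × C → A, ∑ c, ∑ s ∈ Λ.inner,
          (1 - expect ((hardCMDP C Λ hM ε fun x => some (φ x)).runLaw L t)
            (playProb L c s (φ (s, c)))) := by
      intro t ht
      rw [Finset.sum_comm]
      have h2 : ∀ c ∈ (Finset.univ : Finset C), (M * ((H - 1 : ℕ) : ℝ)) *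
          (1 / 4 * Fintype.card (S × C → A)) ≤ ∑ φ : S × C → A, ∑ s ∈ Λ.inner,
          (1 - expect ((hardCMDP C Λ hM ε fun x => some (φ x)).runLaw L t)
            (playProb L c s (φ (s, c)))) := by
        intro c _
        rw [Finset.sum_comm, ← Layering.card_inner (Λ := Λ), ← nsmul_eq_mul]
        refine Finset.card_nsmul_le_sum _ _ _ fun s hs => ?_
        rw [Finset.sum_sub_distrib, Finset.sum_const, Finset.card_univ, nsmul_eq_mul, mul_one]
        have := sum_expect_playProb_best_le (hM := hM) hH hs c L (Finset.mem_range.1 ht).le hA hε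
        linarith
      have h3 := Finset.card_nsmul_le_sum _ _ _ h2
      rw [Finset.card_univ, nsmul_eq_mul] at h3
      refine le_of_eq_of_le ?_ h3
      ring
    have h4 := Finset.card_nsmul_le_sum _ _ _ h1
    rw [Finset.card_range, nsmul_eq_mul] at h4
    have hc : 0 ≤ (ε : ℝ) * (M : ℝ)⁻¹ * (Fintype.card C : ℝ)⁻¹ :=
      mul_nonneg (mul_nonneg ε.2.1 (by positivity)) (by positivity)
    refine le_of_eq_of_le ?_ (mul_le_mul_of_nonneg_left h4 hc)
    rw [Finset.sum_const, Finset.card_univ, nsmul_eq_mul]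
    field_simp
  -- Some `φ` does at least as badly as the average.
  obtain ⟨φ, -, hφ⟩ := Finset.exists_le_of_sum_le Finset.univ_nonempty key
  exact ⟨φ, hφ⟩

lemma realizable_hardCMDP (φ : S × C → A) :
    (hardCMDP C Λ hM ε fun x => some (φ x)).Realizable (bonusClass C A ε) := by
  refine ⟨fun s c a => bonusMean ε (some (φ (s, c)) = some a), fun s => ?_, fun c s a hs => ?_⟩
  · rw [bonusClass, Finset.mem_image]
    exact ⟨fun c => φ (s, c), Finset.mem_univ _, rfl⟩
  · exact meanReward_hardCMDP _ c hs a

end Averaging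

/-! ### The choice of the gap and the resulting rate -/

section Rate

/-- The size of the bonus which is just not detectable in `T` episodes, for `A` actions and `n`
pairs of a context and a state of a layer. -/
def gapSize (A n T : ℝ) : ℝ :=
  min (1 / 4) (Real.sqrt (A * n / T) / 16)

lemma gapSize_mem (A n T : ℝ) : gapSize A n T ∈ Set.Icc (0 : ℝ) (1 / 4) :=
  ⟨le_min (by norm_num) (by positivity), min_le_left _ _⟩

lemma sq_gapSize_mul_le {A n T : ℝ} (hA : 0 ≤ A) (hn : 0 < n) (hT : 0 < T) :
    24 * gapSize A n T ^ 2 * n⁻¹ * T ≤ A / 8 := by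
  have h0 := (gapSize_mem A n T).1
  have h1 : gapSize A n T ^ 2 ≤ (Real.sqrt (A * n / T) / 16) ^ 2 :=
    pow_le_pow_left₀ h0 (min_le_right _ _) 2
  rw [div_pow, Real.sq_sqrt (by positivity)] at h1
  calc 24 * gapSize A n T ^ 2 * n⁻¹ * T ≤ 24 * (A * n / T / 16 ^ 2) * n⁻¹ * T := by gcongr
    _ = A * (24 / 256) := by
        field_simp
        norm_num
    _ ≤ A / 8 := by linarith

/-- If the cap `1 / 4` is active, the bound is linear in `T H`. Otherwise `H ≤ 2 (H - 1)`, `S ≤ 3 M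
(H - 1)` and `x ≤ 2 K` give a factor `12 ≤ 4²` under the root, and `4 / 256 = 1 / (16 · 4)` matches
the gap. -/
lemma rate_le {A T H S x M K : ℝ} (hA : 0 ≤ A) (hT : 0 < T) (hH : 2 ≤ H) (hM : 1 ≤ M)
    (hK : 1 ≤ K) (hS : S = M * (H - 1) + 2) (hx0 : 0 ≤ x) (hx : x ≤ 2 * K) :
    1 / 256 * min (Real.sqrt (T * H * S * A * x)) (T * H) ≤
      gapSize A (K * M) T * T * (H - 1) / 4 := by
  have hH1 : 1 ≤ H - 1 := by linarith
  have hS3 : S ≤ 3 * (M * (H - 1)) := by nlinarith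
  have hS0 : 0 ≤ S := by nlinarith
  rcases le_total (1 / 4 : ℝ) (Real.sqrt (A * (K * M) / T) / 16) with h | h
  · rw [gapSize, min_eq_left h]
    have h1 : min (Real.sqrt (T * H * S * A * x)) (T * H) ≤ T * (2 * (H - 1)) :=
      (min_le_right _ _).trans (mul_le_mul_of_nonneg_left (by linarith) hT.le)
    have h2 : 0 ≤ T * (H - 1) := by positivity
    linarith
  · rw [gapSize, min_eq_right h]
    have h1 : T * H * S * A * x ≤ T * (2 * (H - 1)) * (3 * (M * (H - 1))) * A * (2 * K) := by
      have hH2 : H ≤ 2 * (H - 1) := by linarith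
      gcongr
    have h2 : T * (2 * (H - 1)) * (3 * (M * (H - 1))) * A * (2 * K) ≤
        (4 * (H - 1) * (Real.sqrt (A * (K * M) / T) * T)) ^ 2 := by
      have h3 : (4 * (H - 1) * (Real.sqrt (A * (K * M) / T) * T)) ^ 2 =
          16 * (H - 1) ^ 2 * (A * (K * M) * T) := by
        rw [mul_pow, mul_pow, mul_pow, Real.sq_sqrt (by positivity)]
        field_simp
        ring
      rw [h3]
      have h4 : 0 ≤ (H - 1) ^ 2 * (A * (K * M) * T) := by positivity
      nlinarith
    have h5 : Real.sqrt (T * H * S * A * x) ≤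
        4 * (H - 1) * (Real.sqrt (A * (K * M) / T) * T) :=
      Real.sqrt_le_iff.2 ⟨by positivity, h1.trans h2⟩
    have h6 := (min_le_left (Real.sqrt (T * H * S * A * x)) (T * H)).trans h5
    linarith

/-- Rounding down to an integer number of contexts loses at most a factor two: the ratio is at most
`Nat.log a N + 1`, and `Nat.log a N ≥ 1`. -/
lemma log_div_log_le {a N : ℕ} (ha : 2 ≤ a) (hN : a ≤ N) :
    Real.log N / Real.log a ≤ 2 * (Nat.log a N : ℝ) := by
  have hK : 1 ≤ Nat.log a N := Nat.log_pos (by omega) hN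
  have hlog : 0 < Real.log a := Real.log_pos (by exact_mod_cast ha)
  have h1 : (N : ℝ) ≤ (a : ℝ) ^ (Nat.log a N + 1) := by
    exact_mod_cast (Nat.lt_pow_succ_log_self (by omega : 1 < a) N).le
  have hN0 : (0 : ℝ) < N := by
    have : 0 < N := by omega
    exact_mod_cast this
  rw [div_le_iff₀ hlog]
  calc Real.log N ≤ Real.log ((a : ℝ) ^ (Nat.log a N + 1)) := Real.log_le_log hN0 h1
    _ = ((Nat.log a N + 1 : ℕ) : ℝ) * Real.log a := Real.log_pow _ _
    _ ≤ 2 * (Nat.log a N : ℝ) * Real.log a := by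
        have : ((Nat.log a N + 1 : ℕ) : ℝ) ≤ 2 * (Nat.log a N : ℝ) := by
          exact_mod_cast (by omega : Nat.log a N + 1 ≤ 2 * Nat.log a N)
        gcongr

end Rate

end

end CtxMDP

/-! ### The lower bound -/

open CtxMDP in
theorem mainTheorem4 :
    ∃ κ : ℝ, 0 < κ ∧
      ∀ (S A : Type*) [Fintype S] [Fintype A] (H M N T : ℕ) (δ : ℝ),
        2 ≤ H → 1 ≤ M → 2 ≤ Fintype.card A → Fintype.card A ≤ N →
        0 < δ → δ < 1 →
        Fintype.card S = M * (H - 1) + 2 →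
        8 * (M : ℝ) * Real.log ((Fintype.card S : ℝ) / δ)
            + 2 * (M : ℝ) * (Real.log (N : ℝ) / Real.log (Fintype.card A : ℝ)) ≤ (T : ℝ) →
        ∃ (d : ℕ) (C : Finset (EuclideanSpace ℝ (Fin d))) (P : CtxMDP.LayeredDynamics S A H),
          (∃ p : ℝ, 0 < p ∧ P.MinReachable p) ∧
          ∀ L : Finset (C → A → unitInterval) → CtxMDP.Learner C S A,
            ∃ G : Finset (C → A → unitInterval), G.card ≤ N ∧
              ∃ E : CtxMDP.CMDP C S A H,
                (∀ c, E.dyn c = P) ∧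
                E.Realizable G ∧
                κ * min
                    (Real.sqrt ((T : ℝ) * H * Fintype.card S * Fintype.card A
                      * (Real.log (N : ℝ) / Real.log (Fintype.card A : ℝ))))
                    ((T : ℝ) * H)
                  ≤ E.expectedRegret (L G) T := by
  refine ⟨1 / 256, by norm_num, ?_⟩
  intro S A _ _ H M N T δ hH hM hA hN hδ0 hδ1 hS hT
  classical
  obtain ⟨Λ⟩ := nonempty_layering hH hS
  -- The largest number of contexts for which all maps from contexts to actions fit into a class of
  -- size `N`.
  set K := Nat.log (Fintype.card A) N with hK
  have hK1 : 1 ≤ K := Nat.log_pos (by omega) hN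
  obtain ⟨C, hC⟩ := Infinite.exists_subset_card_eq (EuclideanSpace ℝ (Fin 1)) K
  have hCK : Fintype.card C = K := by rw [Fintype.card_coe, hC]
  have : Nonempty C := Fintype.card_pos_iff.1 (by omega)
  have hMr : (1 : ℝ) ≤ M := by exact_mod_cast hM
  have hKr : (1 : ℝ) ≤ K := by exact_mod_cast hK1
  have hAr : (2 : ℝ) ≤ Fintype.card A := by exact_mod_cast hA
  have hlogA : 0 < Real.log (Fintype.card A : ℝ) := Real.log_pos (by linarith)
  have hlogN : 0 < Real.log (N : ℝ) := Real.log_pos (by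
    have : (Fintype.card A : ℝ) ≤ N := by exact_mod_cast hN
    linarith)
  have hx : 0 < Real.log (N : ℝ) / Real.log (Fintype.card A : ℝ) := div_pos hlogN hlogA
  have hS1 : (1 : ℝ) ≤ (Fintype.card S : ℝ) / δ := by
    rw [le_div_iff₀ hδ0]
    have : (1 : ℝ) ≤ Fintype.card S := by exact_mod_cast (by omega : 1 ≤ Fintype.card S)
    linarith
  -- Only positivity of `T` is drawn from its lower bound; small `T` is handled by the cap on `ε`.
  have hT0 : (0 : ℝ) < T := by
    have h1 : 0 ≤ 8 * (M : ℝ) * Real.log ((Fintype.card S : ℝ) / δ) :=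
      mul_nonneg (by positivity) (Real.log_nonneg hS1)
    have h2 : 0 < 2 * (M : ℝ) * (Real.log (N : ℝ) / Real.log (Fintype.card A : ℝ)) :=
      mul_pos (by positivity) hx
    linarith
  let ε : Set.Icc (0 : ℝ) (1 / 4) := ⟨_, gapSize_mem (Fintype.card A) (K * M) T⟩
  have hε : 24 * (ε : ℝ) ^ 2 * ((Fintype.card C : ℝ)⁻¹ * (M : ℝ)⁻¹) * T ≤
      Fintype.card A / 8 := by
    rw [hCK, ← mul_inv]
    exact sq_gapSize_mul_le (by positivity) (by positivity) hT0
  refine ⟨1, C, Λ.dynamics A hM, ⟨(M : ℝ)⁻¹, by positivity, Layering.minReachable_dynamics A hM⟩,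
    fun L => ?_⟩
  -- The learner is given the class first; the secret `φ` is chosen against the resulting algorithm.
  obtain ⟨φ, hφ⟩ := exists_expectedRegret_ge (Λ := Λ) (by omega : 1 ≤ H) hM
    (L (bonusClass C A ε)) hA hε
  refine ⟨bonusClass C A ε, ?_, hardCMDP C Λ hM ε fun x => some (φ x), fun _ => rfl,
    realizable_hardCMDP φ, le_trans ?_ hφ⟩
  · refine card_bonusClass_le.trans ?_
    rw [hCK]
    exact Nat.pow_log_le_self _ (by omega)
  · have hH1 : ((H - 1 : ℕ) : ℝ) = H - 1 := by
      rw [Nat.cast_sub (by omega), Nat.cast_one]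
    rw [hH1]
    exact rate_le (by positivity) hT0 (by exact_mod_cast hH) hMr hKr
      (by rw [hS]; push_cast [hH1]; ring) hx.le (log_div_log_le hA hN)
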